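/- Let $1\le k<m$, let $U\subset\mathbb R^m$ be an open neighborhood of the origin and let $M=\{\rho=0\}\subset U$ be a smooth hypersurface through the origin, where $\rho\in C^\infty(U,\mathbb R)$ and $d\rho\neq0$ on $M$. Put $U^+=\{\rho>0\}$. Assume that $T_0M=\{x_m=0\}$ and that the second fundamental form of $M$ at $0$, with respect to the unit normal pointing into $U^+$, equals $dx_1^2+\dots+dx_k^2$. (Thus $U^+$ is the convex side of $M$, for instance when $M$ is strictly convex; no other convexity of $M$ is needed.) Let $D$ be a $k$-dimensional distribution on $U^+\cup M$ which is smooth up to $M$ (as a map to the Grassmannian $\mathrm{Gr}(k,\mathbb R^m)$) and integrable in $U^+$, i.e. closed under Lie brackets of smooth local sections. Assume that $D_0$ is spanned by $\frac{\partial}{\partial x_1},\dots,\frac{\partial}{\partial x_k}$ and that, near $0$, $D$ is spanned by some vector fields, smooth up to $M$, whose $\frac{\partial}{\partial x_{k+1}},\dots,\frac{\partial}{\partial x_m}$ components have zero linear parts at the origin. For an integrable $k$-dimensional distribution on an open set, the leaves of the foliation generated by it are its maximal connected integral manifolds. Then: 1. There are an open neighborhood $V\subset U$ of $0$ and a smooth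 integrable $k$-dimensional distribution $D'$ on $V$ that coincides with $D$ on $V\cap(U^+\cup M)$, such that the foliation $\mathcal F'$ of $V$ generated by $D'$ extends the foliation $\mathcal F$ of $V\cap U^+$ generated by $D$ in the following sense: each leaf of $\mathcal F$ is an open subset of a unique leaf of $\mathcal F'$, and each leaf of $\mathcal F'$ meets $V\cap U^+$ in a connected (possibly empty) set. 2. If, moreover, $X_1,\dots,X_k$ are vector fields on $U^+\cup M$, smooth up to $M$, pointwise linearly independent and spanning $D$ on $U^+\cup M$, which commute in $U^+$, then there are $V$ and $D'$ as in 1 (depending on the $X_i$) and pointwise linearly independent, commuting smooth vector fields $X_1',\dots,X_k'$ on $V$ which span $D'$ and coincide with $X_1,\dots,X_k$ on $V\cap(U^+\cup M)$. -/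

import Mathlib

open Set Topology
open scoped ContDiff

section Distributions

variable {E : Type*} [NormedAddCommGroup E] [NormedSpace ℝ E]

/-- The vector fields `Y 1, …, Y k` form a frame of the field of subspaces `D` over the set `S`:
they are smooth on `S` (if `S` has boundary points: smooth up to the boundary), pointwise linearly
independent on `S`, and span `D` at each point of `S`. -/
def IsSmoothFrameOn {k : ℕ} (D : E → Submodule ℝ E) (S : Set E) (Y : Fin k → E → E) : Prop :=
  (∀ i, ContDiffOn ℝ ∞ (Y i) S) ∧
    ∀ p ∈ S, LinearIndependent ℝ (fun i => Y i p) ∧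
      Submodule.span ℝ (range fun i => Y i p) = D p

/-- `D` is a smooth `k`-dimensional distribution over `S`, i.e. smooth as a map from `S` to the
Grassmannian of `k`-planes: near every point of `S` it has a smooth frame over `S`. -/
def IsSmoothDistributionOn (k : ℕ) (D : E → Submodule ℝ E) (S : Set E) : Prop :=
  ∀ p ∈ S, ∃ (W : Set E) (Y : Fin k → E → E), IsOpen W ∧ p ∈ W ∧ IsSmoothFrameOn D (S ∩ W) Y

/-- Integrability of the distribution `D` over the open set `S`: the Lie bracket of any two smooth
local sections of `D` is a section of `D`. -/
def IsIntegrableOn (D : E → Submodule ℝ E) (S : Set E) : Prop :=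
  ∀ (W : Set E) (X Y : E → E), IsOpen W → W ⊆ S →
    ContDiffOn ℝ ∞ X W → ContDiffOn ℝ ∞ Y W →
    (∀ p ∈ W, X p ∈ D p) → (∀ p ∈ W, Y p ∈ D p) →
    ∀ p ∈ W, VectorField.lieBracket ℝ X Y p ∈ D p

/-- The vector fields `X 1, …, X k` commute on the open set `S`. -/
def CommuteOn {k : ℕ} (X : Fin k → E → E) (S : Set E) : Prop :=
  ∀ i j, ∀ p ∈ S, VectorField.lieBracket ℝ (X i) (X j) p = 0

/-- `L` is a connected `k`-dimensional integral manifold of `D`: a connected immersed submanifold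
(a subset with a topology, possibly finer than the induced one, that is covered by open images of
smooth immersions of open subsets of `ℝᵏ`) whose tangent space at each point is given by `D`. -/
def IsConnectedIntegralManifold (k : ℕ) (D : E → Submodule ℝ E) (L : Set E) : Prop :=
  ∃ τ : TopologicalSpace L, @ConnectedSpace L τ ∧
    ∀ p : L, ∃ (O : Set (EuclideanSpace ℝ (Fin k))) (φ : EuclideanSpace ℝ (Fin k) → E)
      (j : O → L),
      IsOpen O ∧ ContDiffOn ℝ ∞ φ O ∧
      (∀ x ∈ O, Function.Injective (fderiv ℝ φ x) ∧
        range (fderiv ℝ φ x) = (D (φ x) : Set E)) ∧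
      @Topology.IsOpenEmbedding O L _ τ j ∧ p ∈ range j ∧ ∀ x : O, (j x : E) = φ x

/-- `L` is a leaf of the foliation of the open set `V` generated by the integrable distribution
`D`: a maximal connected integral manifold of `D` in `V`. -/
def IsLeaf (k : ℕ) (D : E → Submodule ℝ E) (V L : Set E) : Prop :=
  Maximal (fun L' : Set E => L' ⊆ V ∧ IsConnectedIntegralManifold k D L') L

/-- The foliation of `V` generated by `D'` extends the foliation of `V₁ ⊆ V` generated by `D`:
each leaf `L` of the latter is an open subset of a unique leaf of the former, and each leaf of the
former meets `V₁` in a connected (possibly empty) set. -/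
def FoliationExtends (k : ℕ) (D : E → Submodule ℝ E) (V₁ : Set E)
    (D' : E → Submodule ℝ E) (V : Set E) : Prop :=
  (∀ L, IsLeaf k D V₁ L → ∃ L', IsLeaf k D' V L' ∧ (∃ O, IsOpen O ∧ L = L' ∩ O) ∧
    ∀ L'', IsLeaf k D' V L'' → L ⊆ L'' → L'' = L') ∧
  ∀ L', IsLeaf k D' V L' → IsPreconnected (L' ∩ V₁)

/-- `D'` is a smooth integrable `k`-dimensional distribution on the open set `V`, it agrees on `V`
with the distribution `D`, which is given over `U₁ ∪ M`, and the foliation of `V` generated by `D'`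
extends the foliation of `V ∩ U₁` generated by `D`. -/
def IsIntegrableExtension (k : ℕ) (D : E → Submodule ℝ E) (U₁ M : Set E)
    (D' : E → Submodule ℝ E) (V : Set E) : Prop :=
  IsSmoothDistributionOn k D' V ∧ IsIntegrableOn D' V ∧
    (∀ p ∈ V ∩ (U₁ ∪ M), D' p = D p) ∧ FoliationExtends k D (V ∩ U₁) D' V

end Distributions

section Hypersurfaces

variable {E : Type*} [NormedAddCommGroup E] [InnerProductSpace ℝ E]

/-- `ρ` is a smooth defining function on the open set `U`: its zero set in `U` is regular. -/
def IsDefiningFunction (U : Set E) (ρ : E → ℝ) : Prop :=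
  ContDiffOn ℝ ∞ ρ U ∧ ∀ p ∈ U, ρ p = 0 → fderiv ℝ ρ p ≠ 0

/-- The hypersurface in `U` defined by `ρ`. -/
def hypersurface (U : Set E) (ρ : E → ℝ) : Set E := {p | p ∈ U ∧ ρ p = 0}

/-- The side of the hypersurface on which `ρ` is positive. -/
def positiveSide (U : Set E) (ρ : E → ℝ) : Set E := {p | p ∈ U ∧ 0 < ρ p}

/-- The second fundamental form at `p` of the hypersurface `{ρ = 0}`, with respect to the unit
normal `N = ∇ρ / ‖∇ρ‖` pointing to the positive side, evaluated at tangent vectors `v`, `w`.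
For a curve `γ` in the hypersurface with `γ(0) = p`, `γ'(0) = v`, it gives
`⟪γ''(0), N⟫` at `(v, v)`. -/
noncomputable def secondFundamentalForm (ρ : E → ℝ) (p v w : E) : ℝ :=
  -(fderiv ℝ (fderiv ℝ ρ) p v w) / ‖fderiv ℝ ρ p‖

end Hypersurfaces

/-!
The distribution is extended by extending a commuting frame of it, and the extension is made to
commute by a flow which, on the convex side, never leaves that side.

Write `X` for a frame of `D` that is smooth up to `M` and commutes in `U⁺`, seen as a field of linear
maps `ℝᵏ → ℝᵐ`. For the second assertion it is given; for the first one it is obtained from any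
frame by requiring that a fixed linear projection `T` maps it to the standard basis
(`exists_commuting_frame`): brackets of its members are tangent to `D` and lie in the kernel of `T`,
which is complementary to `D`. By Seeley's reflection with infinitely many nodes
(`exists_contDiff_extension_of_halfSpace`, `exists_contDiff_extension_of_nonneg`), `X` extends to a
smooth frame across `M`, which need not commute on the other side.

Consider the map `S p = dρ ∘ X p` with values in the dual of `ℝᵏ`. It vanishes at the origin since
`D 0` is tangent to `M`. As the linear parts of the normal components of the frame vanish, its
derivative in the directions of `D 0` is the Hessian of `ρ` there, which is negative definite as the
second fundamental form is positive definite on `D 0`. Hence `{S = 0}` is near the origin a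
submanifold transverse to `D 0` (`exists_transversal`), and `ρ` is strictly concave along the
integral curves of the combinations `X · y`, with its maximum on the transversal
(`lt_of_strictly_concave_along_curve`). Let `e (y, c)` be the endpoint of the integral curve of
`X · y` on `[0, 1]` that starts at the point `c` of the transversal. If `ρ ≥ 0` at the endpoint, then
`ρ > 0` along the rest of the curve, where the frame commutes, and the Jacobi fields of the flow are
explicit (`jacobi_field_eq`): `∂e/∂y` equals `X`. So `e` is a chart whose slices `c = const` are
tangent to `D` wherever `ρ ≥ 0`, and whose coordinate fields `∂/∂y` agree with `X` there
(`exists_straightening_chart`). These coordinate fields commute, and they are the extension.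

The leaves of the extended foliation are the slices of the chart (`isLeaf_iff_slice`). By the
concavity of `ρ` along the rays `t ↦ (t y, c)`, the part of a slice in `U⁺` is star-shaped about the
transversal, hence connected, so it is a single leaf of the foliation of the part of the chart
domain in `U⁺`.

Smooth dependence of the flow on its data comes from the inverse function theorem in the space of
continuous curves (`exists_smooth_solution`), as composition with a smooth map is a smooth operator
there (`ContinuousMap.contDiff_comp`).
-/

/-! ### Reflection coefficients -/

/-- The power series coefficients of the entire function `P` with `P 0 = 1` and
`P (5 x) = (1 - 5 x) P x`; it vanishes at every power `5 ^ n`. -/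
noncomputable def reflectionAux : ℕ → ℝ
  | 0 => 1
  | k + 1 => -5 * reflectionAux k / (5 ^ (k + 1) - 1)

lemma five_pow_succ_sub_one_pos (k : ℕ) : (0 : ℝ) < 5 ^ (k + 1) - 1 := by
  have : (1 : ℝ) < 5 ^ (k + 1) := one_lt_pow₀ (by norm_num) (by omega)
  linarith

lemma reflectionAux_succ (k : ℕ) :
    reflectionAux (k + 1) * 5 ^ (k + 1) = reflectionAux (k + 1) - 5 * reflectionAux k := by
  have h := (five_pow_succ_sub_one_pos k).ne'
  rw [reflectionAux]
  field_simp
  ring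

lemma reflectionAux_ne_zero (k : ℕ) : reflectionAux k ≠ 0 := by
  induction k with
  | zero => simp [reflectionAux]
  | succ k ih =>
    have h := (five_pow_succ_sub_one_pos k).ne'
    rw [reflectionAux]
    exact div_ne_zero (mul_ne_zero (by norm_num) ih) h

lemma summable_reflectionAux {x : ℝ} (hx : 0 < x) :
    Summable fun k => reflectionAux k * x ^ k := by
  refine summable_of_ratio_test_tendsto_lt_one (l := 0) (by norm_num)
    (Filter.Eventually.of_forall fun k => mul_ne_zero (reflectionAux_ne_zero k) (by positivity)) ?_
  have h1 : Filter.Tendsto (fun k : ℕ => (5 : ℝ) ^ (k + 1) - 1) Filter.atTop Filter.atTop :=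
    Filter.tendsto_atTop_add_const_right _ _
      ((Filter.tendsto_add_atTop_iff_nat 1).2 (tendsto_pow_atTop_atTop_of_one_lt (by norm_num)))
  have h2 := h1.const_div_atTop (5 * x)
  refine h2.congr fun k => ?_
  have h := five_pow_succ_sub_one_pos k
  have h0 := reflectionAux_ne_zero k
  rw [reflectionAux, norm_mul, norm_mul, norm_div, norm_mul, Real.norm_of_nonneg h.le,
    norm_pow, norm_pow, Real.norm_of_nonneg hx.le]
  have : ‖reflectionAux k‖ ≠ 0 := norm_ne_zero_iff.2 h0
  have h5 : ‖(-5 : ℝ)‖ = 5 := by norm_num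
  rw [h5]
  have h' := h.ne'
  field_simp
  ring

lemma tsum_reflectionAux_five_pow (n : ℕ) : ∑' k, reflectionAux k * (5 ^ n : ℝ) ^ k = 0 := by
  have key : ∀ x : ℝ, 0 < x → ∑' k, reflectionAux k * (5 * x) ^ k =
      (1 - 5 * x) * ∑' k, reflectionAux k * x ^ k := by
    intro x hx
    have hs := summable_reflectionAux hx
    have hs5 := summable_reflectionAux (x := 5 * x) (by positivity)
    rw [hs5.tsum_eq_zero_add]
    have h1 : ∀ k, reflectionAux (k + 1) * (5 * x) ^ (k + 1) =
        reflectionAux (k + 1) * x ^ (k + 1) - 5 * x * (reflectionAux k * x ^ k) := by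
      intro k
      rw [mul_pow, ← mul_assoc, reflectionAux_succ]
      ring
    simp_rw [h1]
    rw [((summable_nat_add_iff 1).2 hs).tsum_sub (hs.mul_left _), tsum_mul_left]
    have := hs.tsum_eq_zero_add
    simp only [pow_zero, mul_one] at this ⊢
    linear_combination (-1 : ℝ) * this
  induction n with
  | zero =>
    have := key (1 / 5) (by norm_num)
    norm_num at this
    simpa using this
  | succ n ih =>
    have := key (5 ^ n) (by positivity)
    rw [ih, mul_zero] at this
    rw [← this]
    simp [pow_succ']

/-- Coefficients for a reflection across a hyperplane that matches derivatives of all orders: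
they decay faster than any geometric sequence and all their moments with respect to the
nodes `-5 ^ k` are `1`. -/
lemma exists_reflection_coefficients : ∃ a : ℕ → ℝ,
    (∀ n : ℕ, Summable fun k => |a k| * (5 ^ k) ^ n) ∧
    ∀ n : ℕ, HasSum (fun k => a k * (-5 ^ k) ^ n) 1 := by
  set α : ℕ → ℝ := fun k => reflectionAux k / (5 ^ k + 1) with hα
  have hle : ∀ k, |α k| ≤ |reflectionAux k| := by
    intro k
    have : (1 : ℝ) ≤ 5 ^ k := one_le_pow₀ (by norm_num)
    rw [hα, abs_div, abs_of_pos (by positivity : (0 : ℝ) < 5 ^ k + 1)]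
    exact div_le_self (abs_nonneg _) (by linarith)
  have hs : ∀ n : ℕ, Summable fun k => |α k| * (5 ^ n : ℝ) ^ k := by
    intro n
    refine Summable.of_nonneg_of_le (fun k => by positivity) (fun k => ?_)
      (summable_reflectionAux (x := 5 ^ n) (by positivity)).abs
    rw [abs_mul, abs_of_nonneg (by positivity : (0 : ℝ) ≤ (5 ^ n) ^ k)]
    exact (abs_of_nonneg (by positivity : (0 : ℝ) ≤ (5 ^ n) ^ k)) ▸
      mul_le_mul_of_nonneg_right (hle k) (abs_nonneg _)
  have hs' : ∀ n : ℕ, Summable fun k => α k * (5 ^ n : ℝ) ^ k := by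
    intro n
    refine Summable.of_abs ?_
    convert! hs n using 2 with k
    rw [abs_mul, abs_of_nonneg (by positivity : (0 : ℝ) ≤ (5 ^ n) ^ k)]
  set A : ℕ → ℝ := fun n => ∑' k, α k * (5 ^ n : ℝ) ^ k with hA
  -- the entire function `∑ α k x ^ k` changes sign from `5 ^ n` to `5 ^ (n + 1)`
  have hrec : ∀ n, A (n + 1) = - A n := by
    intro n
    have h0 : A (n + 1) + A n = ∑' k, reflectionAux k * (5 ^ n : ℝ) ^ k := by
      rw [hA, ← (hs' (n + 1)).tsum_add (hs' n)]
      congr 1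
      ext k
      have : (5 : ℝ) ^ k + 1 ≠ 0 := by positivity
      simp only [hα]
      rw [pow_succ, mul_pow]
      field_simp
    rw [tsum_reflectionAux_five_pow] at h0
    linarith
  have hbd : ∀ k, |α k| ≤ (1 / 4) ^ k := by
    have h1 : ∀ k, |reflectionAux k| ≤ (5 / 4) ^ k := by
      intro k
      induction k with
      | zero => simp [reflectionAux]
      | succ k ih =>
        have h := five_pow_succ_sub_one_pos k
        have h4 : (4 : ℝ) ≤ 5 ^ (k + 1) - 1 := by
          have : (1 : ℝ) ≤ 5 ^ k := one_le_pow₀ (by norm_num)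
          rw [pow_succ]; linarith
        rw [reflectionAux, abs_div, abs_mul, abs_of_pos h, div_le_iff₀ h]
        have h5 : |(-5 : ℝ)| = 5 := by norm_num
        rw [h5]
        calc 5 * |reflectionAux k| ≤ 5 * (5 / 4) ^ k := by gcongr
          _ = (5 / 4) ^ (k + 1) * 4 := by ring
          _ ≤ _ := by gcongr
    intro k
    have h5 : (0 : ℝ) < 5 ^ k := by positivity
    rw [hα, abs_div, abs_of_pos (by positivity : (0 : ℝ) < 5 ^ k + 1), div_le_iff₀ (by positivity)]
    calc |reflectionAux k| ≤ (5 / 4) ^ k := h1 k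
      _ = (1 / 4) ^ k * 5 ^ k := by rw [← mul_pow]; norm_num
      _ ≤ _ := by gcongr; linarith
  have hA0 : A 0 ≠ 0 := by
    have hs0 := hs' 0
    have hg : HasSum (fun k : ℕ => (1 / 4 : ℝ) * (1 / 4) ^ k) (1 / 4 * (1 - 1 / 4)⁻¹) :=
      (hasSum_geometric_of_lt_one (by norm_num) (by norm_num)).mul_left _
    have hle : ‖∑' k, α (k + 1) * (5 ^ 0 : ℝ) ^ (k + 1)‖ ≤ 1 / 4 * (1 - 1 / 4)⁻¹ := by
      refine tsum_of_norm_bounded hg fun k => ?_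
      simpa [pow_succ'] using hbd (k + 1)
    have : A 0 = α 0 + ∑' k, α (k + 1) * (5 ^ 0 : ℝ) ^ (k + 1) := by
      rw [hA]; simpa using hs0.tsum_eq_zero_add
    rw [this]
    have h0 : α 0 = 1 / 2 := by simp [hα, reflectionAux]; norm_num
    rw [h0]
    rw [Real.norm_eq_abs] at hle
    have := (abs_le.1 hle).1
    norm_num at this
    intro h
    norm_num at h
    linarith
  have hAn : ∀ n, A n = (-1) ^ n * A 0 := by
    intro n
    induction n with
    | zero => simp
    | succ n ih => rw [hrec, ih]; ring
  refine ⟨fun k => α k / A 0, fun n => ?_, fun n => ?_⟩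
  · convert! (hs n).mul_left |A 0|⁻¹ using 2 with k
    rw [abs_div, ← pow_mul, ← pow_mul, mul_comm k n]
    ring
  · have := ((hs' n).hasSum.mul_left ((-1) ^ n / A 0))
    have h1 : (-1) ^ n / A 0 * ∑' k, α k * (5 ^ n : ℝ) ^ k = 1 := by
      change (-1) ^ n / A 0 * A n = 1
      rw [hAn n]
      have : ((-1 : ℝ) ^ n) * (-1) ^ n = 1 := by rw [← mul_pow]; simp
      field_simp
      rw [pow_two, this]
    rw [h1] at this
    convert! this using 2 with k
    rw [neg_pow, ← pow_mul, ← pow_mul, mul_comm k n]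
    ring

/-! ### Smooth extension from a half-space -/

section HalfSpace

variable {E : Type*} [NormedAddCommGroup E] [NormedSpace ℝ E]
  {F : Type*} [NormedAddCommGroup F] [NormedSpace ℝ F]

/-- Term-by-term differentiation of a series on a convex set which need not be open. -/
lemma hasFDerivWithinAt_tsum_of_convex {s : Set E} (hs : Convex ℝ s) {u : ℕ → ℝ}
    (hu : Summable u) {f : ℕ → E → F} {f' : ℕ → E → E →L[ℝ] F}
    (hf : ∀ n, ∀ x ∈ s, HasFDerivWithinAt (f n) (f' n x) s x)
    (hb : ∀ n, ∀ x ∈ s, ‖f' n x‖ ≤ u n) (hsum : ∀ x ∈ s, Summable fun n => f n x)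
    {x : E} (hx : x ∈ s) {L : E →L[ℝ] F} (hL : HasSum (fun n => f' n x) L) :
    HasFDerivWithinAt (fun y => ∑' n, f n y) L s x := by
  rw [hasFDerivWithinAt_iff_isLittleO, Asymptotics.isLittleO_iff]
  intro c hc
  have hu0 : ∀ n, 0 ≤ u n := fun n => (norm_nonneg _).trans (hb n x hx)
  -- the tails of `∑ u n` bound the Lipschitz constants of the tails of the series
  obtain ⟨N, hN⟩ := ((tendsto_sum_nat_add u).eventually (gt_mem_nhds (by positivity :
    (0 : ℝ) < c / 3))).exists
  have hut : Summable fun n => u (n + N) := (summable_nat_add_iff N).2 hu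
  have htail : ∀ y ∈ s, ‖∑' n, f (n + N) y - ∑' n, f (n + N) x‖ ≤ c / 3 * ‖y - x‖ := by
    intro y hy
    rw [← ((summable_nat_add_iff N).2 (hsum y hy)).tsum_sub ((summable_nat_add_iff N).2 (hsum x hx))]
    refine (tsum_of_norm_bounded (hut.hasSum.mul_right ‖y - x‖) fun n => ?_).trans ?_
    · exact hs.norm_image_sub_le_of_norm_hasFDerivWithin_le (hf (n + N)) (hb (n + N)) hx hy
    · gcongr
  have htailL : ∀ v, ‖(∑' n, f' (n + N) x) v‖ ≤ c / 3 * ‖v‖ := by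
    intro v
    refine (ContinuousLinearMap.le_opNorm _ _).trans ?_
    gcongr
    exact (tsum_of_norm_bounded hut.hasSum fun n => hb _ x hx).trans hN.le
  have hfin : HasFDerivWithinAt (fun y => ∑ n ∈ Finset.range N, f n y)
      (∑ n ∈ Finset.range N, f' n x) s x :=
    HasFDerivWithinAt.fun_sum fun n _ => hf n x hx
  rw [hasFDerivWithinAt_iff_isLittleO, Asymptotics.isLittleO_iff] at hfin
  filter_upwards [hfin (by positivity : (0 : ℝ) < c / 3), self_mem_nhdsWithin] with y hy hys
  rw [← (hsum y hys).sum_add_tsum_nat_add N, ← (hsum x hx).sum_add_tsum_nat_add N, ← hL.tsum_eq,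
    ← hL.summable.sum_add_tsum_nat_add N]
  have h1 := htail y hys
  have h2 := htailL (y - x)
  calc _ = ‖(∑ n ∈ Finset.range N, f n y - ∑ n ∈ Finset.range N, f n x
          - (∑ n ∈ Finset.range N, f' n x) (y - x))
        + (∑' n, f (n + N) y - ∑' n, f (n + N) x) - (∑' n, f' (n + N) x) (y - x)‖ := by
        congr 1
        rw [add_apply]
        abel
    _ ≤ c / 3 * ‖y - x‖ + c / 3 * ‖y - x‖ + c / 3 * ‖y - x‖ :=
        (norm_sub_le _ _).trans (add_le_add ((norm_add_le _ _).trans (add_le_add hy h1)) h2)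
    _ = c * ‖y - x‖ := by ring

/-- A Taylor series on each of two closed sets is a Taylor series on their union. -/
lemma HasFTaylorSeriesUpToOn.union_of_isClosed {n : ℕ∞ω} {f : E → F}
    {p : E → FormalMultilinearSeries ℝ E F} {s t : Set E}
    (hs : HasFTaylorSeriesUpToOn n f p s) (ht : HasFTaylorSeriesUpToOn n f p t)
    (hsc : IsClosed s) (htc : IsClosed t) : HasFTaylorSeriesUpToOn n f p (s ∪ t) where
  zero_eq x hx := hx.elim (hs.zero_eq x) (ht.zero_eq x)
  fderivWithin m hm x hx := by
    have key : ∀ u : Set E, HasFTaylorSeriesUpToOn n f p u → IsClosed u →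
        HasFDerivWithinAt (p · m) (p x m.succ).curryLeft u x := by
      intro u hu huc
      by_cases hxu : x ∈ u
      · exact hu.fderivWithin m hm x hxu
      · exact HasFDerivWithinAt.of_notMem_closure (by rwa [huc.closure_eq])
    exact (key s hs hsc).union (key t ht htc)
  cont m hm := (hs.cont m hm).union_of_isClosed (ht.cont m hm) hsc htc

/-- The linear map that multiplies the direction `e`, transverse to the hyperplane `ℓ = 0`,
by `c`, and fixes this hyperplane; here `ℓ e = 1`. -/
noncomputable def transverseScaling (ℓ : E →L[ℝ] ℝ) (e : E) (c : ℝ) : E →L[ℝ] E :=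
  (ContinuousLinearMap.id ℝ E - ℓ.smulRight e) + c • ℓ.smulRight e

lemma transverseScaling_apply (ℓ : E →L[ℝ] ℝ) (e : E) (c : ℝ) (v : E) :
    transverseScaling ℓ e c v = (v - ℓ v • e) + c • ℓ v • e := by
  simp [transverseScaling]

lemma apply_transverseScaling {ℓ : E →L[ℝ] ℝ} {e : E} (he : ℓ e = 1) (c : ℝ) (v : E) :
    ℓ (transverseScaling ℓ e c v) = c * ℓ v := by
  simp [transverseScaling_apply, he]

lemma transverseScaling_eq_self {ℓ : E →L[ℝ] ℝ} {e v : E} (hv : ℓ v = 0) (c : ℝ) :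
    transverseScaling ℓ e c v = v := by
  simp [transverseScaling_apply, hv]

lemma norm_transverseScaling_le (ℓ : E →L[ℝ] ℝ) (e : E) (k : ℕ) :
    ‖transverseScaling ℓ e (-5 ^ k)‖ ≤ (1 + 2 * ‖ℓ.smulRight e‖) * 5 ^ k := by
  have h5 : (1 : ℝ) ≤ 5 ^ k := one_le_pow₀ (by norm_num)
  have h1 : ‖ContinuousLinearMap.id ℝ E‖ ≤ 1 := ContinuousLinearMap.norm_id_le
  have h2 : ‖((-5 ^ k : ℝ)) • ℓ.smulRight e‖ = 5 ^ k * ‖ℓ.smulRight e‖ := by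
    rw [norm_smul, norm_neg, norm_pow]; norm_num
  calc ‖transverseScaling ℓ e (-5 ^ k)‖
      ≤ (‖ContinuousLinearMap.id ℝ E‖ + ‖ℓ.smulRight e‖) + ‖((-5 ^ k : ℝ)) • ℓ.smulRight e‖ :=
        (norm_add_le _ _).trans (add_le_add_left (norm_sub_le _ _) _)
    _ ≤ (1 + ‖ℓ.smulRight e‖) + 5 ^ k * ‖ℓ.smulRight e‖ := by rw [h2]; gcongr
    _ ≤ (5 ^ k + 5 ^ k * ‖ℓ.smulRight e‖) + 5 ^ k * ‖ℓ.smulRight e‖ := by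
        gcongr; exact le_mul_of_one_le_left (norm_nonneg _) h5
    _ = _ := by ring

/-- A series of multilinear maps rescaled in the direction `e`: since a multilinear map is
polynomial in the scaling factor, the moment conditions make the series sum to the map itself. -/
lemma hasSum_comp_transverseScaling {a : ℕ → ℝ} {c : ℕ → ℝ}
    (ha : ∀ n : ℕ, HasSum (fun k => a k * (c k) ^ n) 1) (ℓ : E →L[ℝ] ℝ) (e : E)
    {n : ℕ} (q : E [×n]→L[ℝ] F) (v : Fin n → E) :
    HasSum (fun k => a k • q fun i => transverseScaling ℓ e (c k) (v i)) (q v) := by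
  classical
  set x : Fin n → E := fun i => v i - ℓ (v i) • e
  set y : Fin n → E := fun i => ℓ (v i) • e
  have hsc : ∀ (b : ℝ) (s : Finset (Fin n)),
      q (s.piecewise x (b • y)) = b ^ (sᶜ).card • q (s.piecewise x y) := by
    intro b s
    have h := q.toMultilinearMap.map_piecewise_smul (fun _ => b) (s.piecewise x y) sᶜ
    have h' : (sᶜ).piecewise (fun i => b • s.piecewise x y i) (s.piecewise x y) =
        s.piecewise x (b • y) := by
      ext i
      by_cases hi : i ∈ s <;> simp [hi]
    rw [h', Finset.prod_const] at h
    exact h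
  have hexp : ∀ b : ℝ, q (x + b • y) = ∑ s : Finset (Fin n), b ^ (sᶜ).card • q (s.piecewise x y) := by
    intro b
    rw [← Finset.sum_congr rfl fun s _ => hsc b s]
    exact q.toMultilinearMap.map_add_univ x (b • y)
  have h1 : q v = ∑ s : Finset (Fin n), (1 : ℝ) • q (s.piecewise x y) := by
    have := hexp 1
    simp only [one_pow] at this
    rw [← this]
    congr 1
    ext i
    simp [x, y]
  have h2 : ∀ k, a k • q (fun i => transverseScaling ℓ e (c k) (v i)) =
      ∑ s : Finset (Fin n), (a k * c k ^ (sᶜ).card) • q (s.piecewise x y) := by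
    intro k
    have : (fun i => transverseScaling ℓ e (c k) (v i)) = x + c k • y := by
      ext i
      simp [x, y, transverseScaling_apply]
    rw [this, hexp, Finset.smul_sum]
    simp_rw [smul_smul]
  rw [h1]
  simp_rw [h2]
  exact hasSum_sum fun s _ => (ha _).smul_const _

variable [CompleteSpace F]

/-- **Seeley extension.** A function on a closed half-space which is smooth up to the boundary,
with bounded derivatives of each order, extends to a smooth function on the whole space. -/
theorem exists_contDiff_extension_of_halfSpace {ℓ : E →L[ℝ] ℝ} {e : E} (he : ℓ e = 1)
    {f : E → F} {p : E → FormalMultilinearSeries ℝ E F}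
    (hp : HasFTaylorSeriesUpToOn ∞ f p {x | 0 ≤ ℓ x})
    (hb : ∀ n, ∃ B, ∀ x, 0 ≤ ℓ x → ‖p x n‖ ≤ B) :
    ∃ g : E → F, ContDiff ℝ ∞ g ∧ ∀ x, 0 ≤ ℓ x → g x = f x := by
  classical
  obtain ⟨a, ha, ha'⟩ := exists_reflection_coefficients
  choose B hB using hb
  set A : ℕ → E →L[ℝ] E := fun k => transverseScaling ℓ e (-5 ^ k) with hA
  set C : ℝ := 1 + 2 * ‖ℓ.smulRight e‖
  set s : Set E := {x | 0 ≤ ℓ x}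
  set t : Set E := {x | ℓ x ≤ 0}
  have hsc : IsClosed s := isClosed_le continuous_const ℓ.continuous
  have htc : IsClosed t := isClosed_le ℓ.continuous continuous_const
  have htconv : Convex ℝ t := convex_halfSpace_le ℓ.isLinear 0
  have hAt : ∀ k, ∀ x ∈ t, A k x ∈ s := by
    intro k x hx
    change 0 ≤ ℓ (A k x)
    rw [hA, apply_transverseScaling he]
    exact mul_nonneg_of_nonpos_of_nonpos (by simp) hx
  -- the terms of the Taylor series of the reflected function
  set T : ∀ n : ℕ, ℕ → E → E [×n]→L[ℝ] F := fun n k x =>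
    a k • (p (A k x) n).compContinuousLinearMap fun _ => A k with hT
  have hTb : ∀ n k, ∀ x ∈ t, ‖T n k x‖ ≤ |a k| * (5 ^ k) ^ n * (C ^ n * B n) := by
    intro n k x hx
    have hC : 0 ≤ C := by positivity
    have hB0 : 0 ≤ B n := (norm_nonneg _).trans (hB n _ (hAt k x hx))
    calc ‖T n k x‖ ≤ |a k| * (‖p (A k x) n‖ * ∏ _i : Fin n, ‖A k‖) := by
          rw [hT, norm_smul, Real.norm_eq_abs]
          gcongr
          exact ContinuousMultilinearMap.norm_compContinuousLinearMap_le _ _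
      _ ≤ |a k| * (B n * (C * 5 ^ k) ^ n) := by
          rw [Finset.prod_const, Finset.card_univ, Fintype.card_fin]
          gcongr
          · exact hB n _ (hAt k x hx)
          · exact norm_transverseScaling_le ℓ e k
      _ = _ := by rw [mul_pow]; ring
  have hu : ∀ n, Summable fun k => |a k| * (5 ^ k) ^ n * (C ^ n * B n) := fun n =>
    (ha n).mul_right _
  have hTs : ∀ n, ∀ x ∈ t, Summable fun k => T n k x := fun n x hx =>
    Summable.of_norm_bounded (hu n) fun k => hTb n k x hx
  have hcomp : ∀ k, HasFTaylorSeriesUpToOn ∞ (f ∘ A k)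
      (fun x n => (p (A k x) n).compContinuousLinearMap fun _ => A k) t := fun k =>
    (hp.compContinuousLinearMap (A k)).mono fun x hx => hAt k x hx
  have hq : HasFTaylorSeriesUpToOn ∞ (fun x => ∑' k, a k • f (A k x))
      (fun x n => ∑' k, T n k x) t := by
    refine ⟨fun x hx => ?_, fun n hn x hx => ?_, fun n hn => ?_⟩
    · have h1 := (hTs 0 x hx).hasSum.mapL
        (continuousMultilinearCurryFin0 ℝ E F).toContinuousLinearEquiv.toContinuousLinearMap
      refine h1.tsum_eq.symm.trans (tsum_congr fun k => ?_)
      change a k • ((p (A k x) 0).compContinuousLinearMap fun _ => A k).curry0 = _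
      rw [(hcomp k).zero_eq x hx]
      rfl
    · have hcurry : ∀ q : E [×(n + 1)]→L[ℝ] F, q.curryLeft =
        (continuousMultilinearCurryLeftEquiv ℝ (fun _ : Fin (n + 1) => E) F) q := fun q => rfl
      refine hasFDerivWithinAt_tsum_of_convex htconv (hu (n + 1))
        (f' := fun k x => (T (n + 1) k x).curryLeft) ?_ ?_ (hTs n) hx ?_
      · intro k y hy
        exact ((hcomp k).fderivWithin n hn y hy).const_smul (a k)
      · intro k y hy
        rw [hcurry, LinearIsometryEquiv.norm_map]
        exact hTb (n + 1) k y hy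
      · simp_rw [hcurry]
        exact (hTs (n + 1) x hx).hasSum.mapL (continuousMultilinearCurryLeftEquiv ℝ
          (fun _ : Fin (n + 1) => E) F).toContinuousLinearEquiv.toContinuousLinearMap
    · exact continuousOn_tsum (fun k => ((hcomp k).cont n hn).const_smul (a k)) (hu n) (hTb n)
  -- on the hyperplane both series agree
  have hbd : ∀ x, ℓ x = 0 → ∀ n, ∑' k, T n k x = p x n := by
    intro x hx n
    have hxt : x ∈ t := le_of_eq hx
    ext v
    have h1 := (hTs n x hxt).hasSum.mapL (ContinuousMultilinearMap.apply ℝ (fun _ : Fin n => E) F v)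
    refine h1.unique ?_
    convert! hasSum_comp_transverseScaling ha' ℓ e (p x n) v using 2 with k
    simp [hT, hA, transverseScaling_eq_self hx]
  have hbd0 : ∀ x, ℓ x = 0 → ∑' k, a k • f (A k x) = f x := by
    intro x hx
    rw [← hq.zero_eq x (le_of_eq hx), hbd x hx 0, hp.zero_eq x (ge_of_eq hx)]
  set g : E → F := fun x => if 0 ≤ ℓ x then f x else ∑' k, a k • f (A k x) with hg
  set P : E → FormalMultilinearSeries ℝ E F := fun x n =>
    if 0 ≤ ℓ x then p x n else ∑' k, T n k x with hP
  have hs' : HasFTaylorSeriesUpToOn ∞ g P s :=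
    (hp.congr (f₁ := g) fun x hx => if_pos hx).congr_series fun n _ x hx => (if_pos hx).symm
  have ht' : HasFTaylorSeriesUpToOn ∞ g P t := by
    refine (hq.congr (f₁ := g) fun x hx => ?_).congr_series fun n _ x hx => ?_
    · by_cases h : 0 ≤ ℓ x
      · rw [hbd0 x (le_antisymm hx h)]; exact if_pos h
      · exact if_neg h
    · by_cases h : 0 ≤ ℓ x
      · exact (hbd x (le_antisymm hx h) n).trans (if_pos h).symm
      · exact (if_neg h).symm
  have huniv : s ∪ t = univ := by
    ext x
    simpa [s, t] using le_total 0 (ℓ x)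
  have hfull := hs'.union_of_isClosed ht' hsc htc
  rw [huniv, hasFTaylorSeriesUpToOn_univ_iff] at hfull
  exact ⟨g, hfull.contDiff, fun x hx => if_pos hx⟩

end HalfSpace

/-! ### Smooth extension across a hypersurface -/

lemma exists_contDiffBump_closedBall_subset {E : Type*} [NormedAddCommGroup E]
    {c : E} {s : Set E} (hs : s ∈ 𝓝 c) :
    ∃ χ : ContDiffBump c, Metric.closedBall c χ.rOut ⊆ s := by
  obtain ⟨r, hr, hrs⟩ := Metric.nhds_basis_closedBall.mem_iff.1 hs
  exact ⟨⟨r / 2, r, by positivity, by linarith⟩, hrs⟩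

section Extension

variable {E : Type*} [NormedAddCommGroup E] [NormedSpace ℝ E]
  {F : Type*} [NormedAddCommGroup F] [NormedSpace ℝ F]

/-- Inverse function theorem for smooth maps, with smoothness of the inverse on a whole open set. -/
theorem exists_smooth_openPartialHomeomorph [CompleteSpace E] {f : E → F} {f' : E ≃L[ℝ] F}
    {a : E} {s : Set E} (hs : IsOpen s) (ha : a ∈ s) (hf : ContDiffOn ℝ ∞ f s)
    (hf' : HasFDerivAt f (f' : E →L[ℝ] F) a) :
    ∃ e : OpenPartialHomeomorph E F, ⇑e = f ∧ a ∈ e.source ∧ e.source ⊆ s ∧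
      ContDiffOn ℝ ∞ e.symm e.target := by
  have hfa : ContDiffAt ℝ ∞ f a := hf.contDiffAt (hs.mem_nhds ha)
  set e₀ := hfa.toOpenPartialHomeomorph f hf' (by simp)
  have hcont : ContinuousOn (fderiv ℝ f) s := hf.continuousOn_fderiv_of_isOpen hs (by simp)
  set s' : Set E := s ∩ fderiv ℝ f ⁻¹' range ((↑) : (E ≃L[ℝ] F) → E →L[ℝ] F)
  have hs' : IsOpen s' := hcont.isOpen_inter_preimage hs ContinuousLinearEquiv.isOpen
  refine ⟨e₀.restrOpen s' hs', rfl, ?_, ?_, ?_⟩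
  · refine ⟨hfa.mem_toOpenPartialHomeomorph_source hf' (by simp), ha, ?_⟩
    rw [mem_preimage, hf'.fderiv]
    exact mem_range_self f'
  · exact fun x hx => hx.2.1
  · intro y hy
    set e := e₀.restrOpen s' hs'
    have hx : e.symm y ∈ s' := (e.map_target hy).2
    obtain ⟨L, hL⟩ := hx.2
    have hd : ContDiffAt ℝ ∞ f (e.symm y) := hf.contDiffAt (hs.mem_nhds hx.1)
    refine (e.contDiffAt_symm (f₀' := L) hy ?_ hd).contDiffWithinAt
    rw [hL]
    exact (hd.differentiableAt (by simp)).hasFDerivAt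

variable [FiniteDimensional ℝ E]

/-- Multiplication by a bump function supported in the open set `s` makes a function that is
smooth on `t ∩ s` smooth on all of `t`. -/
lemma ContDiffBump.contDiffOn_smul {c : E} (χ : ContDiffBump c) {s t : Set E} (hs : IsOpen s)
    (hχ : Metric.closedBall c χ.rOut ⊆ s) {h : E → F} (hh : ContDiffOn ℝ ∞ h (t ∩ s)) :
    ContDiffOn ℝ ∞ (fun x => χ x • h x) t := by
  intro x hx
  by_cases hxs : x ∈ s
  · have h1 : ContDiffWithinAt ℝ ∞ h t x :=
      (contDiffWithinAt_inter (hs.mem_nhds hxs)).1 (hh x ⟨hx, hxs⟩)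
    exact (χ.contDiff.contDiffAt.contDiffWithinAt).smul h1
  · have hx' : x ∉ tsupport χ := by
      rw [χ.tsupport_eq]
      exact fun h => hxs (hχ h)
    have h0 : (fun x => χ x • h x) =ᶠ[𝓝 x] fun _ => 0 := by
      filter_upwards [notMem_tsupport_iff_eventuallyEq.1 hx'] with y hy
      simp [hy]
    exact (contDiffAt_const.congr_of_eventuallyEq h0).contDiffWithinAt

variable [CompleteSpace F]

/-- A function which is smooth on one side of a regular hypersurface `ρ = 0`, up to the
hypersurface, coincides near a given point of the hypersurface with the restriction of a smooth
function on the whole space. -/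
theorem exists_contDiff_extension_of_nonneg {U : Set E} (hU : IsOpen U) {x₀ : E} (hx₀ : x₀ ∈ U)
    {ρ : E → ℝ} (hρ : ContDiffOn ℝ ∞ ρ U) (hρ' : fderiv ℝ ρ x₀ ≠ 0) {f : E → F}
    (hf : ContDiffOn ℝ ∞ f {x | x ∈ U ∧ 0 ≤ ρ x}) :
    ∃ g : E → F, ContDiff ℝ ∞ g ∧ ∀ᶠ x in 𝓝 x₀, 0 ≤ ρ x → g x = f x := by
  set ℓ := fderiv ℝ ρ x₀ with hℓ
  obtain ⟨e, he⟩ : ∃ e, ℓ e = 1 := by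
    obtain ⟨v, hv⟩ : ∃ v, ℓ v ≠ 0 := by
      by_contra! h
      exact hρ' (ContinuousLinearMap.ext h)
    exact ⟨(ℓ v)⁻¹ • v, by simp [hv]⟩
  -- straighten the hypersurface to the hyperplane `ℓ = 0`
  set ψ : E → E := fun x => x + (ρ x - ℓ x) • e with hψ
  have hψs : ContDiffOn ℝ ∞ ψ U :=
    contDiffOn_id.add ((hρ.sub ℓ.contDiff.contDiffOn).smul contDiffOn_const)
  have hψd : HasFDerivAt ψ ((ContinuousLinearEquiv.refl ℝ E : E ≃L[ℝ] E) : E →L[ℝ] E) x₀ := by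
    have h1 : HasFDerivAt ρ ℓ x₀ :=
      ((hρ.contDiffAt (hU.mem_nhds hx₀)).differentiableAt (by simp)).hasFDerivAt
    have h2 := (hasFDerivAt_id x₀).add ((h1.sub ℓ.hasFDerivAt).smul_const e)
    convert! h2 using 1
    ext v
    simp
  obtain ⟨Ψ, hΨ, hxΨ, hΨU, hΨs⟩ := exists_smooth_openPartialHomeomorph hU hx₀ hψs hψd
  have hℓψ : ∀ x, ℓ (Ψ x) = ρ x := by
    intro x
    rw [hΨ, hψ]
    simp [he]
  set H : Set E := {x | 0 ≤ ℓ x}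
  obtain ⟨χ, hχ⟩ := exists_contDiffBump_closedBall_subset
    (Ψ.open_target.mem_nhds (Ψ.map_source hxΨ))
  set f₂ : E → F := fun z => χ z • f (Ψ.symm z) with hf₂
  have hf₂s : ContDiffOn ℝ ∞ f₂ H := by
    refine χ.contDiffOn_smul Ψ.open_target hχ (hf.comp (hΨs.mono inter_subset_right) ?_)
    intro z hz
    refine ⟨hΨU (Ψ.map_target hz.2), ?_⟩
    rw [← hℓψ, Ψ.right_inv hz.2]
    exact hz.1
  have hHu : UniqueDiffOn ℝ H := by
    refine uniqueDiffOn_convex (convex_halfSpace_ge ℓ.isLinear 0) ⟨e, ?_⟩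
    exact mem_interior.2 ⟨{x | 0 < ℓ x}, fun x hx => LT.lt.le (α := ℝ) hx,
      isOpen_lt continuous_const ℓ.continuous, by simp [he]⟩
  have hHc : IsClosed H := isClosed_le continuous_const ℓ.continuous
  have hbdd : ∀ n, ∃ B, ∀ x, 0 ≤ ℓ x → ‖ftaylorSeriesWithin ℝ f₂ H x n‖ ≤ B := by
    intro n
    have hK : IsCompact (H ∩ Metric.closedBall (Ψ x₀) χ.rOut) :=
      (isCompact_closedBall _ _).inter_left hHc
    obtain ⟨B, hB⟩ := hK.exists_bound_of_continuousOn
      ((hf₂s.continuousOn_iteratedFDerivWithin (m := n) (mod_cast le_top) hHu).mono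
        inter_subset_left)
    refine ⟨max B 0, fun x hx => ?_⟩
    by_cases hxb : x ∈ Metric.closedBall (Ψ x₀) χ.rOut
    · exact (hB x ⟨hx, hxb⟩).trans (le_max_left _ _)
    · have hx' : x ∉ tsupport χ := by rwa [χ.tsupport_eq]
      have h0 : f₂ =ᶠ[𝓝 x] fun _ => 0 := by
        filter_upwards [notMem_tsupport_iff_eventuallyEq.1 hx'] with y hy
        simp [hf₂, hy]
      have h1 := (h0.filter_mono (nhdsWithin_le_nhds (s := H))).iteratedFDerivWithin_eq
        (𝕜 := ℝ) h0.eq_of_nhds n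
      change ‖iteratedFDerivWithin ℝ n f₂ H x‖ ≤ _
      rw [h1]
      have : iteratedFDerivWithin ℝ n (fun _ : E => (0 : F)) H x = 0 := by
        have := congrFun (iteratedFDerivWithin_fun_zero (𝕜 := ℝ) (E := E) (F := F) (s := H) (i := n)) x
        exact this
      rw [this, norm_zero]
      exact le_max_right _ _
  obtain ⟨g₁, hg₁, hg₁'⟩ := exists_contDiff_extension_of_halfSpace he
    (hf₂s.ftaylorSeriesWithin hHu) hbdd
  obtain ⟨χ₂, hχ₂⟩ := exists_contDiffBump_closedBall_subset (Ψ.open_source.mem_nhds hxΨ)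
  refine ⟨fun x => χ₂ x • g₁ (Ψ x), ?_, ?_⟩
  · rw [← contDiffOn_univ]
    refine χ₂.contDiffOn_smul Ψ.open_source hχ₂ (hg₁.comp_contDiffOn ?_)
    rw [hΨ]
    exact hψs.mono fun x hx => hΨU hx.2
  · have hc : ContinuousAt Ψ x₀ := Ψ.continuousAt hxΨ
    filter_upwards [χ₂.eventuallyEq_one, hc.eventually χ.eventuallyEq_one,
      Ψ.open_source.mem_nhds hxΨ] with x h1 h2 h3 h4
    rw [h1, Pi.one_apply, one_smul, hg₁' _ (by rwa [hℓψ]), hf₂]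
    simp only
    rw [h2, Pi.one_apply, one_smul, Ψ.left_inv h3]

end Extension

/-! ### Smoothness of composition operators on spaces of continuous maps -/

section Composition

variable {α : Type*} [TopologicalSpace α] [CompactSpace α]

/-- Pointwise application of a continuous family of linear maps to a continuous function. -/
noncomputable def pointwiseApply (α : Type*) [TopologicalSpace α] [CompactSpace α]
    (E F : Type*) [NormedAddCommGroup E] [NormedSpace ℝ E]
    [NormedAddCommGroup F] [NormedSpace ℝ F] : C(α, E →L[ℝ] F) →L[ℝ] C(α, E) →L[ℝ] C(α, F) :=
  LinearMap.mkContinuous₂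
    (LinearMap.mk₂ ℝ (fun (A : C(α, E →L[ℝ] F)) (δ : C(α, E)) =>
        (⟨fun t => A t (δ t), A.continuous.clm_apply δ.continuous⟩ : C(α, F)))
      (fun _ _ _ => by ext; simp) (fun _ _ _ => by ext; simp)
      (fun _ _ _ => by ext; simp) (fun _ _ _ => by ext; simp)) 1
    (fun A δ => by
      rw [one_mul]
      refine (ContinuousMap.norm_le _ (by positivity)).2 fun t => ?_
      exact ((A t).le_opNorm (δ t)).trans
        (mul_le_mul (A.norm_coe_le_norm t) (δ.norm_coe_le_norm t) (norm_nonneg (δ t)) (norm_nonneg A)))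

@[simp] lemma pointwiseApply_apply {E F : Type*} [NormedAddCommGroup E] [NormedSpace ℝ E]
    [NormedAddCommGroup F] [NormedSpace ℝ F] (A : C(α, E →L[ℝ] F)) (δ : C(α, E)) (t : α) :
    pointwiseApply α E F A δ t = A t (δ t) := rfl

/-- The composition operator `γ ↦ f ∘ γ` is differentiable if `f` is `C¹`. -/
lemma ContinuousMap.hasFDerivAt_comp {E F : Type*} [NormedAddCommGroup E] [NormedSpace ℝ E]
    [NormedAddCommGroup F] [NormedSpace ℝ F] (f : C(E, F)) (f' : C(E, E →L[ℝ] F))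
    (hf : ∀ x, HasFDerivAt f (f' x) x) (γ : C(α, E)) :
    HasFDerivAt (fun γ : C(α, E) => f.comp γ) (pointwiseApply α E F (f'.comp γ)) γ := by
  rw [hasFDerivAt_iff_isLittleO, Asymptotics.isLittleO_iff]
  intro c hc
  -- the derivative is uniformly continuous near the compact range of `γ`
  have hK : IsCompact (range γ) := isCompact_range γ.continuous
  have hu := hK.uniformContinuousAt_of_continuousAt f' (fun a _ => f'.continuous.continuousAt)
    (Metric.dist_mem_uniformity hc)
  obtain ⟨r, hr, hru⟩ := Metric.mem_uniformity_dist.1 hu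
  filter_upwards [Metric.ball_mem_nhds γ hr] with δ hδ
  refine (ContinuousMap.norm_le _ (by positivity)).2 fun t => ?_
  have hδt : dist (δ t) (γ t) ≤ dist δ γ := ContinuousMap.dist_apply_le_dist t
  have h1 := (convex_ball (γ t) r).norm_image_sub_le_of_norm_hasFDerivWithin_le'
    (f := f) (f' := f') (φ := f' (γ t)) (C := c) (x := γ t) (y := δ t)
    (fun x _ => (hf x).hasFDerivWithinAt)
    (fun x hx => by
      have := hru (a := γ t) (b := x) (by rw [dist_comm]; exact hx) (mem_range_self t)
      rw [← dist_eq_norm, dist_comm]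
      exact le_of_lt this)
    (Metric.mem_ball_self hr) (lt_of_le_of_lt hδt hδ)
  refine h1.trans ?_
  gcongr
  rw [← dist_eq_norm, ← dist_eq_norm]
  exact hδt

universe u

/-- The composition operator `γ ↦ f ∘ γ` is smooth if `f` is smooth. -/
theorem ContinuousMap.contDiff_comp {E F : Type u} [NormedAddCommGroup E]
    [NormedSpace ℝ E] [NormedAddCommGroup F] [NormedSpace ℝ F] (f : C(E, F))
    (hf : ContDiff ℝ ∞ f) : ContDiff ℝ ∞ fun γ : C(α, E) => f.comp γ := by
  rw [contDiff_infty]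
  intro n
  induction n generalizing F with
  | zero => exact contDiff_zero.2 (ContinuousMap.continuous_postcomp f)
  | succ n ih =>
    have hf' : ContDiff ℝ ∞ (fderiv ℝ f) := hf.fderiv_right (by simp)
    refine contDiff_succ_iff_hasFDerivAt.2
      ⟨_, ?_, fun γ => ContinuousMap.hasFDerivAt_comp f ⟨fderiv ℝ f, hf'.continuous⟩
        (fun x => (hf.differentiable (by simp) x).hasFDerivAt) γ⟩
    exact (pointwiseApply α E F).contDiff.comp (ih ⟨fderiv ℝ f, hf'.continuous⟩ hf')

end Composition

/-! ### Smooth dependence of solutions of differential equations on parameters -/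

section Flow

/-- The extension of a continuous function on `[0, 1]` to the real line by its boundary values. -/
noncomputable def extendLine {E : Type*} [NormedAddCommGroup E] (h : C(unitInterval, E))
    (s : ℝ) : E :=
  h (projIcc 0 1 zero_le_one s)

lemma continuous_extendLine {E : Type*} [NormedAddCommGroup E] (h : C(unitInterval, E)) :
    Continuous (extendLine h) :=
  h.continuous.comp continuous_projIcc

lemma extendLine_coe {E : Type*} [NormedAddCommGroup E] (h : C(unitInterval, E))
    (t : unitInterval) : extendLine h t = h t := by
  rw [extendLine, projIcc_val]

lemma norm_extendLine_le {E : Type*} [NormedAddCommGroup E] (h : C(unitInterval, E)) (s : ℝ) :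
    ‖extendLine h s‖ ≤ ‖h‖ :=
  h.norm_coe_le_norm _

universe u

variable {A E : Type u} [NormedAddCommGroup A] [NormedSpace ℝ A]
  [NormedAddCommGroup E] [NormedSpace ℝ E]

/-- Constant maps, as a continuous linear map. -/
noncomputable def constCLM (α : Type*) [TopologicalSpace α] [CompactSpace α] (E : Type*)
    [NormedAddCommGroup E] [NormedSpace ℝ E] : E →L[ℝ] C(α, E) :=
  LinearMap.mkContinuous
    { toFun := ContinuousMap.const α
      map_add' := fun _ _ => rfl
      map_smul' := fun _ _ => rfl } 1
    (fun x => by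
      rw [one_mul]
      exact (ContinuousMap.norm_le _ (norm_nonneg _)).2 fun t => le_rfl)

@[simp] lemma constCLM_apply {α : Type*} [TopologicalSpace α] [CompactSpace α] (x : E) (t : α) :
    constCLM α E x t = x := rfl

/-- The operator of integration from `0`, on continuous functions on `[0, 1]`. -/
noncomputable def primitiveCLM (E : Type*) [NormedAddCommGroup E] [NormedSpace ℝ E] :
    C(unitInterval, E) →L[ℝ] C(unitInterval, E) :=
  LinearMap.mkContinuous
    { toFun := fun h => ⟨fun t => ∫ s in (0 : ℝ)..t, extendLine h s,
        (intervalIntegral.continuous_primitive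
          (fun a b => (continuous_extendLine h).intervalIntegrable a b) 0).comp
            continuous_subtype_val⟩
      map_add' := fun h₁ h₂ => by
        ext t
        exact intervalIntegral.integral_add ((continuous_extendLine h₁).intervalIntegrable _ _)
          ((continuous_extendLine h₂).intervalIntegrable _ _)
      map_smul' := fun c h => by
        ext t
        exact intervalIntegral.integral_smul c _ } 1
    (fun h => by
      rw [one_mul]
      refine (ContinuousMap.norm_le _ (norm_nonneg _)).2 fun t => ?_
      refine (intervalIntegral.norm_integral_le_of_norm_le_const (C := ‖h‖)
        fun s _ => norm_extendLine_le h s).trans ?_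
      have h1 : |(t : ℝ) - 0| ≤ 1 := by
        rw [sub_zero, abs_of_nonneg t.2.1]; exact t.2.2
      exact mul_le_of_le_one_right (norm_nonneg _) h1)

lemma primitiveCLM_apply {E : Type*} [NormedAddCommGroup E] [NormedSpace ℝ E]
    (h : C(unitInterval, E)) (t : unitInterval) :
    primitiveCLM E h t = ∫ s in (0 : ℝ)..t, extendLine h s := rfl

/-- The pair formed by a constant parameter and a curve, as a curve in the product. -/
noncomputable def paramCurve (A E : Type*) [NormedAddCommGroup A] [NormedSpace ℝ A]
    [NormedAddCommGroup E] [NormedSpace ℝ E] :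
    A × C(unitInterval, E) →L[ℝ] C(unitInterval, A × E) :=
  ((ContinuousLinearMap.inl ℝ A E).compLeftContinuous ℝ unitInterval ∘L constCLM unitInterval A) ∘L
      ContinuousLinearMap.fst ℝ A _ +
    (ContinuousLinearMap.inr ℝ A E).compLeftContinuous ℝ unitInterval ∘L
      ContinuousLinearMap.snd ℝ A _

@[simp] lemma paramCurve_apply (a : A) (γ : C(unitInterval, E)) (t : unitInterval) :
    paramCurve A E (a, γ) t = (a, γ t) := by
  simp [paramCurve]

variable [CompleteSpace E]

/-- A continuous curve satisfying an integral equation on `[0, 1]` is the restriction of a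
differentiable curve on the real line. -/
lemma exists_hasDerivAt_of_eq_add_primitive {γ h : C(unitInterval, E)} {x : E}
    (hγ : γ = constCLM unitInterval E x + primitiveCLM E h) :
    ∃ g : ℝ → E, g 0 = x ∧ (∀ t : unitInterval, g t = γ t) ∧
      ∀ t, HasDerivAt g (extendLine h t) t := by
  refine ⟨fun t => x + ∫ s in (0 : ℝ)..t, extendLine h s, by simp, fun t => ?_, fun t => ?_⟩
  · rw [hγ]; rfl
  · exact ((continuous_extendLine h).integral_hasStrictDerivAt 0 t).hasDerivAt.const_add x

variable [CompleteSpace A]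

/-- Solutions on `[0, 1]` of `γ' = f (a, γ)`, `γ 0 = x`, where `f` is smooth and `f (0, ·) = 0`,
depend smoothly on `(a, x)` near the origin, and are unique among small curves. This is the inverse
function theorem in the space of curves, at the zero curve; as `f (0, ·) = 0`, the linearization
of the integral equation in the direction of the curve is the identity. -/
theorem exists_smooth_solution {f : A × E → E} (hf : ContDiff ℝ ∞ f) (hf0 : ∀ x, f (0, x) = 0)
    {ε : ℝ} (hε : 0 < ε) :
    ∃ r > 0, ∃ ε' > 0, ∃ Γ : A × E → C(unitInterval, E),
      ContDiffOn ℝ ∞ Γ (Metric.ball 0 r) ∧ Γ 0 = 0 ∧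
      ∀ p ∈ Metric.ball (0 : A × E) r, ‖Γ p‖ < ε ∧ ‖Γ p‖ < ε' ∧
        Γ p = constCLM unitInterval E p.2 + primitiveCLM E
          ((⟨f, hf.continuous⟩ : C(A × E, E)).comp (paramCurve A E (p.1, Γ p))) ∧
        ∀ γ : C(unitInterval, E), ‖γ‖ < ε' →
          γ = constCLM unitInterval E p.2 + primitiveCLM E
            ((⟨f, hf.continuous⟩ : C(A × E, E)).comp (paramCurve A E (p.1, γ))) → γ = Γ p := by
  set Ω := C(unitInterval, E)
  set N : C(unitInterval, A × E) → Ω := fun γ => (⟨f, hf.continuous⟩ : C(A × E, E)).comp γ with hN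
  have hNs : ContDiff ℝ ∞ N := ContinuousMap.contDiff_comp _ hf
  set G : (A × E) × Ω → Ω := fun q => q.2 - constCLM unitInterval E q.1.2 -
    primitiveCLM E (N (paramCurve A E (q.1.1, q.2))) with hG
  set H : (A × E) × Ω → (A × E) × Ω := fun q => (q.1, G q) with hH
  have hGs : ContDiff ℝ ∞ G := by
    have h1 : ContDiff ℝ ∞ fun q : (A × E) × Ω => paramCurve A E (q.1.1, q.2) :=
      (paramCurve A E).contDiff.comp (contDiff_fst.fst.prodMk contDiff_snd)
    exact (contDiff_snd.sub ((constCLM unitInterval E).contDiff.comp contDiff_fst.snd)).sub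
      ((primitiveCLM E).contDiff.comp (hNs.comp h1))
  have hHs : ContDiff ℝ ∞ H := contDiff_fst.prodMk hGs
  have hG0 : ∀ x γ, G ((0, x), γ) = γ - constCLM unitInterval E x := by
    intro x γ
    have : N (paramCurve A E (0, γ)) = 0 := by
      ext t
      change f (paramCurve A E (0, γ) t) = 0
      rw [paramCurve_apply, hf0]
    simp only [hG, this, map_zero, sub_zero]
  -- block triangular form of the derivative at the origin
  set L : A × E →L[ℝ] Ω := (fderiv ℝ G 0).comp (ContinuousLinearMap.inl ℝ (A × E) Ω)
  set H' : ((A × E) × Ω) ≃L[ℝ] (A × E) × Ω :=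
    (ContinuousLinearEquiv.refl ℝ (A × E)).skewProd (ContinuousLinearEquiv.refl ℝ Ω) L
  have hH' : HasFDerivAt H (H' : (A × E) × Ω →L[ℝ] (A × E) × Ω) 0 := by
    have hGd : HasFDerivAt G (fderiv ℝ G 0) 0 := (hGs.differentiable (by simp) 0).hasFDerivAt
    have h1 : HasFDerivAt H ((ContinuousLinearMap.fst ℝ (A × E) Ω).prod (fderiv ℝ G 0)) 0 :=
      hasFDerivAt_fst.prodMk hGd
    have h2 : (fderiv ℝ G 0).comp (ContinuousLinearMap.inr ℝ (A × E) Ω) =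
        ContinuousLinearMap.id ℝ Ω := by
      have h3 : HasFDerivAt (fun γ : Ω => G (0, γ))
          ((fderiv ℝ G 0).comp (ContinuousLinearMap.inr ℝ (A × E) Ω)) 0 :=
        HasFDerivAt.comp (0 : Ω) (g := G) hGd (ContinuousLinearMap.inr ℝ (A × E) Ω).hasFDerivAt
      have h4 : (fun γ : Ω => G (0, γ)) = id := by
        ext1 γ
        have := hG0 0 γ
        rw [map_zero, sub_zero] at this
        exact this
      rw [h4] at h3
      exact h3.unique (hasFDerivAt_id 0)
    convert! h1 using 1
    refine ContinuousLinearMap.ext fun q => ?_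
    have h5 : fderiv ℝ G 0 q = fderiv ℝ G 0 (q.1, 0) + fderiv ℝ G 0 (0, q.2) := by
      rw [← map_add]; simp
    have h6 : fderiv ℝ G 0 (0, q.2) = q.2 := DFunLike.congr_fun h2 q.2
    change (q.1, q.2 + fderiv ℝ G 0 (q.1, 0)) = (q.1, fderiv ℝ G 0 q)
    rw [h5, h6, add_comm]
  have hH0 : H 0 = 0 := by
    have := hG0 0 0
    simp only [map_zero, sub_zero] at this
    exact Prod.ext rfl this
  obtain ⟨e, he, h0e, -, hes⟩ := exists_smooth_openPartialHomeomorph isOpen_univ (mem_univ _)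
    hHs.contDiffOn hH'
  have h0t : (0 : (A × E) × Ω) ∈ e.target := by
    have := e.map_source h0e
    rwa [he, hH0] at this
  obtain ⟨ε', hε', hεe⟩ := Metric.isOpen_iff.1 e.open_source 0 h0e
  set Γ : A × E → Ω := fun p => (e.symm (p, 0)).2 with hΓ
  have hin : Continuous fun p : A × E => ((p, 0) : (A × E) × Ω) := by fun_prop
  have hΓ0 : Γ 0 = 0 := by
    have : e.symm 0 = 0 := by
      have := e.left_inv h0e
      rwa [he, hH0] at this
    change (e.symm 0).2 = 0
    rw [this]; rfl
  have htn : ∀ᶠ p in 𝓝 (0 : A × E), ((p, 0) : (A × E) × Ω) ∈ e.target :=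
    hin.continuousAt.eventually (e.open_target.mem_nhds h0t)
  have hΓat : ContinuousAt Γ 0 := by
    have h1 : ContinuousAt e.symm ((0, 0) : (A × E) × Ω) := e.symm.continuousAt h0t
    exact continuousAt_snd.comp (h1.comp (x := (0 : A × E)) (f := fun p => (p, (0 : Ω)))
      hin.continuousAt)
  have hΓn : ∀ᶠ p in 𝓝 (0 : A × E), ‖Γ p‖ < min ε ε' := by
    have := hΓat.norm
    rw [ContinuousAt, hΓ0, norm_zero] at this
    exact this.eventually_lt_const (lt_min hε hε')
  obtain ⟨r₀, hr₀, hball⟩ := Metric.eventually_nhds_iff_ball.1 (htn.and hΓn)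
  have hsmall : Metric.ball (0 : A × E) (min r₀ ε') ⊆ Metric.ball 0 r₀ :=
    Metric.ball_subset_ball (min_le_left _ _)
  have hsol : ∀ p γ, G (p, γ) = 0 ↔ γ = constCLM unitInterval E p.2 + primitiveCLM E
      (N (paramCurve A E (p.1, γ))) := by
    intro p γ
    rw [hG]
    simp only
    rw [sub_sub, sub_eq_zero]
  refine ⟨min r₀ ε', lt_min hr₀ hε', ε', hε', Γ, ?_, hΓ0, fun p hp => ?_⟩
  · refine contDiff_snd.comp_contDiffOn (hes.comp (contDiff_id.prodMk contDiff_const).contDiffOn ?_)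
    exact fun p hp => (hball p (hsmall hp)).1
  · obtain ⟨hpt, hpn⟩ := hball p (hsmall hp)
    have hHe : H (e.symm (p, 0)) = (p, 0) := by rw [← he]; exact e.right_inv hpt
    have h1 : e.symm (p, 0) = (p, Γ p) :=
      Prod.ext (show (H (e.symm (p, 0))).1 = p by rw [hHe]) rfl
    have hGp : G (p, Γ p) = 0 := by rw [← h1]; exact (Prod.ext_iff.1 hHe).2
    refine ⟨hpn.trans_le (min_le_left _ _), hpn.trans_le (min_le_right _ _),
      (hsol _ _).1 hGp, fun γ hγ hγe => ?_⟩
    have h2 : ((p, γ) : (A × E) × Ω) ∈ e.source := by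
      refine hεe ?_
      rw [mem_ball_zero_iff, Prod.norm_def]
      exact max_lt (mem_ball_zero_iff.1 (Metric.ball_subset_ball (min_le_right _ _) hp)) hγ
    have h3 : e (p, γ) = (p, 0) := by
      rw [he]
      exact Prod.ext rfl ((hsol _ _).2 hγe)
    rw [hΓ]
    simp only
    rw [← h3, e.left_inv h2]

end Flow

/-! ### Foliations by the slices of a coordinate system -/

section TopologicalSlices

variable {E N : Type*} [TopologicalSpace E] [TopologicalSpace N] {k : ℕ}

/-- The points of `R` whose second coordinate with respect to `e` is `c`. -/
def slice (e : OpenPartialHomeomorph (EuclideanSpace ℝ (Fin k) × N) E) (R : Set E) (c : N) :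
    Set E :=
  {p | p ∈ R ∧ (e.symm p).2 = c}

/-- The first coordinates of the points of the slice of `R` at height `c`. -/
def sliceDomain (e : OpenPartialHomeomorph (EuclideanSpace ℝ (Fin k) × N) E) (R : Set E) (c : N) :
    Set (EuclideanSpace ℝ (Fin k)) :=
  {y | (y, c) ∈ e.source ∧ e (y, c) ∈ R}

variable {e : OpenPartialHomeomorph (EuclideanSpace ℝ (Fin k) × N) E} {R : Set E} {c : N}

lemma image_sliceDomain (hR : R ⊆ e.target) :
    (fun y => e (y, c)) '' sliceDomain e R c = slice e R c := by
  ext p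
  constructor
  · rintro ⟨y, hy, rfl⟩
    exact ⟨hy.2, by rw [e.left_inv hy.1]⟩
  · rintro ⟨hp, hc⟩
    have h1 : ((e.symm p).1, c) = e.symm p := Prod.ext rfl hc.symm
    refine ⟨(e.symm p).1, ⟨?_, ?_⟩, ?_⟩
    · rw [h1]; exact e.map_target (hR hp)
    · rw [h1, e.right_inv (hR hp)]; exact hp
    · simp only [h1, e.right_inv (hR hp)]

lemma isPreconnected_slice (hR : R ⊆ e.target) (h : IsPreconnected (sliceDomain e R c)) :
    IsPreconnected (slice e R c) := by
  rw [← image_sliceDomain hR]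
  refine h.image _ (e.continuousOn.comp (by fun_prop) fun y hy => hy.1)

lemma isOpen_sliceDomain (hR : IsOpen R) : IsOpen (sliceDomain e R c) :=
  (e.isOpen_inter_preimage hR).preimage (by fun_prop : Continuous fun y => (y, c))

end TopologicalSlices

lemma minSmoothness_two_le_infty : minSmoothness ℝ 2 ≤ ∞ := by
  rw [minSmoothness_of_isRCLikeNormedField]
  exact WithTop.coe_le_coe.2 (le_top : (2 : ℕ∞) ≤ ⊤)

section Slices

variable {E : Type*} [NormedAddCommGroup E] [NormedSpace ℝ E]
  {H : Type*} [NormedAddCommGroup H] [NormedSpace ℝ H]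

lemma OpenPartialHomeomorph.hasFDerivAt_of_contDiffOn {e : OpenPartialHomeomorph H E}
    (he : ContDiffOn ℝ ∞ e e.source) {x : H} (hx : x ∈ e.source) :
    HasFDerivAt e (fderiv ℝ e x) x :=
  ((he.contDiffAt (e.open_source.mem_nhds hx)).differentiableAt (by simp)).hasFDerivAt

lemma OpenPartialHomeomorph.fderiv_symm_fderiv {e : OpenPartialHomeomorph H E}
    (he : ContDiffOn ℝ ∞ e e.source) (hes : ContDiffOn ℝ ∞ e.symm e.target)
    {x : H} (hx : x ∈ e.source) (v : H) :
    fderiv ℝ e.symm (e x) (fderiv ℝ e x v) = v := by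
  have h1 := e.symm.hasFDerivAt_of_contDiffOn (by simpa using hes) (e.map_source hx)
  have h2 := h1.comp x (OpenPartialHomeomorph.hasFDerivAt_of_contDiffOn he hx)
  have h3 : (e.symm ∘ e) =ᶠ[𝓝 x] id := by
    filter_upwards [e.open_source.mem_nhds hx] with y hy using e.left_inv hy
  exact DFunLike.congr_fun (h2.unique ((hasFDerivAt_id x).congr_of_eventuallyEq h3)) v

lemma OpenPartialHomeomorph.fderiv_fderiv_symm {e : OpenPartialHomeomorph H E}
    (he : ContDiffOn ℝ ∞ e e.source) (hes : ContDiffOn ℝ ∞ e.symm e.target)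
    {p : E} (hp : p ∈ e.target) (v : E) :
    fderiv ℝ e (e.symm p) (fderiv ℝ e.symm p v) = v := by
  have := e.symm.fderiv_symm_fderiv (by simpa using hes) (by simpa using he) (x := p) hp v
  simpa using this

variable {k : ℕ} {N : Type*} [NormedAddCommGroup N] [NormedSpace ℝ N]

/-- The distribution on the target of a coordinate system `e` that is tangent to the slices on
which the second coordinate is constant. -/
noncomputable def sliceDistribution (e : OpenPartialHomeomorph (EuclideanSpace ℝ (Fin k) × N) E)
    (p : E) : Submodule ℝ E :=
  LinearMap.range ((fderiv ℝ e (e.symm p)).comp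
    (ContinuousLinearMap.inl ℝ (EuclideanSpace ℝ (Fin k)) N)).toLinearMap

variable {e : OpenPartialHomeomorph (EuclideanSpace ℝ (Fin k) × N) E} {R : Set E} {c : N}
  {D : E → Submodule ℝ E}

lemma mem_sliceDistribution_iff (he : ContDiffOn ℝ ∞ e e.source)
    (hes : ContDiffOn ℝ ∞ e.symm e.target) {p : E} (hp : p ∈ e.target) (v : E) :
    v ∈ sliceDistribution e p ↔ fderiv ℝ (fun q => (e.symm q).2) p v = 0 := by
  have hd := e.symm.hasFDerivAt_of_contDiffOn (by simpa using hes) hp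
  rw [hd.snd.fderiv]
  constructor
  · rintro ⟨η, rfl⟩
    have := OpenPartialHomeomorph.fderiv_symm_fderiv he hes (e.map_target hp) (η, 0)
    rw [e.right_inv hp] at this
    exact congrArg Prod.snd this
  · intro hv
    refine ⟨(fderiv ℝ e.symm p v).1, ?_⟩
    have h1 : ((fderiv ℝ e.symm p v).1, (0 : N)) = fderiv ℝ e.symm p v := Prod.ext rfl hv.symm
    change fderiv ℝ e (e.symm p) ((fderiv ℝ e.symm p v).1, 0) = v
    rw [h1]
    exact OpenPartialHomeomorph.fderiv_fderiv_symm he hes hp v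

/-- A first integral of a distribution is constant on connected integral manifolds. -/
lemma IsConnectedIntegralManifold.eq_of_le_ker {L : Set E}
    (hL : IsConnectedIntegralManifold k D L) {F : E → N}
    (hF : ∀ p ∈ L, DifferentiableAt ℝ F p) (hD : ∀ p ∈ L, ∀ v ∈ D p, fderiv ℝ F p v = 0) :
    ∃ c, ∀ p ∈ L, F p = c := by
  obtain ⟨τ, hconn, hchart⟩ := hL
  have hloc : IsLocallyConstant fun p : L => F p := by
    rw [IsLocallyConstant.iff_exists_open]
    intro p
    obtain ⟨O, φ, j, hO, hφ, hφD, hj, ⟨x, hx⟩, hjφ⟩ := hchart p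
    obtain ⟨r, hr, hball⟩ := Metric.isOpen_iff.1 hO x x.2
    set B : Set O := (↑) ⁻¹' Metric.ball (x : EuclideanSpace ℝ (Fin k)) r
    have hB : IsOpen B := Metric.isOpen_ball.preimage continuous_subtype_val
    refine ⟨j '' B, hj.isOpenMap B hB, ⟨x, Metric.mem_ball_self hr, hx⟩, ?_⟩
    rintro _ ⟨y, hy, rfl⟩
    rw [← hx, hjφ, hjφ]
    have hmem : ∀ z ∈ O, φ z ∈ L := fun z hz => by
      rw [← hjφ ⟨z, hz⟩]; exact (j ⟨z, hz⟩).2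
    have hd : ∀ z ∈ Metric.ball (x : EuclideanSpace ℝ (Fin k)) r,
        HasFDerivAt (F ∘ φ) (0 : EuclideanSpace ℝ (Fin k) →L[ℝ] N) z := by
      intro z hz
      have h1 : HasFDerivAt φ (fderiv ℝ φ z) z :=
        ((hφ.contDiffAt (hO.mem_nhds (hball hz))).differentiableAt (by simp)).hasFDerivAt
      have h2 := (hF _ (hmem z (hball hz))).hasFDerivAt.comp z h1
      convert! h2 using 1
      refine ContinuousLinearMap.ext fun v => ?_
      refine (hD _ (hmem z (hball hz)) _ ?_).symm
      have := (hφD z (hball hz)).2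
      rw [← SetLike.mem_coe, ← this]
      exact mem_range_self v
    exact (convex_ball (x : EuclideanSpace ℝ (Fin k)) r).is_const_of_fderivWithin_eq_zero
      (𝕜 := ℝ) (f := F ∘ φ) (y := (x : EuclideanSpace ℝ (Fin k)))
      (fun z hz => (hd z hz).differentiableAt.differentiableWithinAt)
      (fun z hz => ((hd z hz).hasFDerivWithinAt.fderivWithin
        (Metric.isOpen_ball.uniqueDiffWithinAt hz))) hy (Metric.mem_ball_self hr)
  obtain ⟨q⟩ : Nonempty L := hconn.toNonempty
  exact ⟨F q, fun p hp => hloc.apply_eq_of_preconnectedSpace ⟨p, hp⟩ q⟩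

/-- A nonempty connected slice is an integral manifold. -/
lemma isConnectedIntegralManifold_slice (he : ContDiffOn ℝ ∞ e e.source)
    (hes : ContDiffOn ℝ ∞ e.symm e.target) (hR : IsOpen R) (hRt : R ⊆ e.target)
    (hD : ∀ p ∈ R, D p = sliceDistribution e p) (hconn : IsPreconnected (sliceDomain e R c))
    (hne : (slice e R c).Nonempty) :
    IsConnectedIntegralManifold k D (slice e R c) := by
  refine ⟨inferInstance, isConnected_iff_connectedSpace.1 ⟨hne, isPreconnected_slice hRt hconn⟩,
    fun p => ?_⟩
  have hmem : ∀ y ∈ sliceDomain e R c, e (y, c) ∈ slice e R c := fun y hy => by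
    rw [← image_sliceDomain hRt]; exact mem_image_of_mem _ hy
  have hmem' : ∀ q ∈ slice e R c, ((e.symm q).1, c) = e.symm q := fun q hq =>
    Prod.ext rfl hq.2.symm
  have hmem'' : ∀ q ∈ slice e R c, (e.symm q).1 ∈ sliceDomain e R c := fun q hq => by
    refine ⟨?_, ?_⟩
    · rw [hmem' q hq]; exact e.map_target (hRt hq.1)
    · rw [hmem' q hq, e.right_inv (hRt hq.1)]; exact hq.1
  have hcont : ContinuousOn (fun y => e (y, c)) (sliceDomain e R c) :=
    e.continuousOn.comp (by fun_prop) fun y hy => hy.1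
  have hcont' : ContinuousOn (fun q => (e.symm q).1) (slice e R c) :=
    continuous_fst.comp_continuousOn (e.continuousOn_symm.mono fun q hq => hRt hq.1)
  set j : sliceDomain e R c ≃ₜ slice e R c :=
    { toFun := fun y => ⟨e (y, c), hmem y y.2⟩
      invFun := fun q => ⟨(e.symm q).1, hmem'' q q.2⟩
      left_inv := fun y => Subtype.ext (by simp [e.left_inv y.2.1])
      right_inv := fun q => Subtype.ext (by simp [hmem' q q.2, e.right_inv (hRt q.2.1)])
      continuous_toFun := (continuousOn_iff_continuous_domRestrict.1 hcont).subtype_mk _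
      continuous_invFun := (continuousOn_iff_continuous_domRestrict.1 hcont').subtype_mk _ }
  have hfd : ∀ y ∈ sliceDomain e R c, HasFDerivAt (fun y => e (y, c)) ((fderiv ℝ e (y, c)).comp
      (ContinuousLinearMap.inl ℝ (EuclideanSpace ℝ (Fin k)) N)) y := fun y hy =>
    (OpenPartialHomeomorph.hasFDerivAt_of_contDiffOn he hy.1).comp y
      (hasFDerivAt_prodMk_left y c)
  refine ⟨sliceDomain e R c, fun y => e (y, c), j, isOpen_sliceDomain hR, ?_, ?_,
    j.isOpenEmbedding, j.surjective p, fun _ => rfl⟩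
  · exact he.comp (contDiff_id.prodMk contDiff_const).contDiffOn fun y hy => hy.1
  · intro y hy
    rw [(hfd y hy).fderiv]
    constructor
    · intro v w hvw
      have h1 := OpenPartialHomeomorph.fderiv_symm_fderiv he hes hy.1 (v, 0)
      have h2 := OpenPartialHomeomorph.fderiv_symm_fderiv he hes hy.1 (w, 0)
      have h3 : fderiv ℝ e (y, c) (v, 0) = fderiv ℝ e (y, c) (w, 0) := hvw
      rw [h3, h2] at h1
      exact (congrArg Prod.fst h1).symm
    · rw [hD _ hy.2, sliceDistribution, e.left_inv hy.1]
      rfl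

/-- If all slices are connected, the leaves are the nonempty slices. -/
lemma isLeaf_iff_slice (he : ContDiffOn ℝ ∞ e e.source)
    (hes : ContDiffOn ℝ ∞ e.symm e.target) (hR : IsOpen R) (hRt : R ⊆ e.target)
    (hD : ∀ p ∈ R, D p = sliceDistribution e p)
    (hconn : ∀ c, IsPreconnected (sliceDomain e R c)) {L : Set E} :
    IsLeaf k D R L ↔ ∃ c, L = slice e R c ∧ L.Nonempty := by
  have hsub : ∀ L' : Set E, L' ⊆ R → IsConnectedIntegralManifold k D L' →
      ∃ c, L' ⊆ slice e R c := by
    intro L' hL'R hL'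
    obtain ⟨c, hc⟩ := hL'.eq_of_le_ker (F := fun q => (e.symm q).2)
      (fun p hp => (e.symm.hasFDerivAt_of_contDiffOn (by simpa using hes)
        (hRt (hL'R hp))).snd.differentiableAt)
      (fun p hp v hv => by
        rw [hD p (hL'R hp)] at hv
        exact (mem_sliceDistribution_iff he hes (hRt (hL'R hp)) v).1 hv)
    exact ⟨c, fun p hp => ⟨hL'R hp, hc p hp⟩⟩
  have hnon : ∀ L' : Set E, IsConnectedIntegralManifold k D L' → L'.Nonempty := by
    rintro L' ⟨τ, hc, -⟩
    exact nonempty_coe_sort.1 hc.toNonempty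
  constructor
  · intro hL
    obtain ⟨c, hc⟩ := hsub L hL.prop.1 hL.prop.2
    have hLn := hnon L hL.prop.2
    refine ⟨c, subset_antisymm hc (hL.le_of_ge ⟨fun p hp => hp.1, ?_⟩ hc), hLn⟩
    exact isConnectedIntegralManifold_slice he hes hR hRt hD (hconn c) (hLn.mono hc)
  · rintro ⟨c, rfl, hne⟩
    refine ⟨⟨fun p hp => hp.1,
      isConnectedIntegralManifold_slice he hes hR hRt hD (hconn c) hne⟩, ?_⟩
    rintro L' ⟨hL'R, hL'⟩ hle
    obtain ⟨c', hc'⟩ := hsub L' hL'R hL'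
    obtain ⟨p, hp⟩ := hne
    have : c' = c := (hc' (hle hp)).2.symm.trans hp.2
    rw [← this]
    exact hc'

/-- The slices of a coordinate system foliate its target, in a way that extends the foliation
of a smaller open set whenever the slices of the latter are connected. -/
lemma foliationExtends_sliceDistribution (he : ContDiffOn ℝ ∞ e e.source)
    (hes : ContDiffOn ℝ ∞ e.symm e.target) {U₁ : Set E} (hU₁ : IsOpen (e.target ∩ U₁))
    (hD : ∀ p ∈ e.target ∩ U₁, D p = sliceDistribution e p)
    (hconn : ∀ c, IsPreconnected (sliceDomain e e.target c))
    (hconn' : ∀ c, IsPreconnected (sliceDomain e (e.target ∩ U₁) c)) :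
    FoliationExtends k D (e.target ∩ U₁) (sliceDistribution e) e.target := by
  have h1 : ∀ {L}, IsLeaf k D (e.target ∩ U₁) L ↔ _ := fun {L} =>
    isLeaf_iff_slice he hes hU₁ inter_subset_left hD hconn' (L := L)
  have h2 : ∀ {L}, IsLeaf k (sliceDistribution e) e.target L ↔ _ := fun {L} =>
    isLeaf_iff_slice he hes e.open_target subset_rfl (fun _ _ => rfl) hconn (L := L)
  have h3 : ∀ c, slice e (e.target ∩ U₁) c = slice e e.target c ∩ (e.target ∩ U₁) := by
    intro c
    ext p
    simp only [slice, mem_ofPred_eq, mem_inter_iff]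
    tauto
  constructor
  · intro L hL
    obtain ⟨c, rfl, hne⟩ := h1.1 hL
    refine ⟨slice e e.target c, h2.2 ⟨c, rfl, ?_⟩, ⟨_, hU₁, h3 c⟩, fun L'' hL'' hle => ?_⟩
    · rw [h3] at hne; exact hne.left
    · obtain ⟨c', rfl, -⟩ := h2.1 hL''
      obtain ⟨p, hp⟩ := hne
      rw [← (hle hp).2, ← hp.2]
  · intro L' hL'
    obtain ⟨c, rfl, -⟩ := h2.1 hL'
    rw [← h3]
    exact isPreconnected_slice inter_subset_left (hconn' c)

/-- The distribution tangent to the slices is involutive, as the kernel of the differential of the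
second coordinate. -/
lemma isIntegrableOn_sliceDistribution (he : ContDiffOn ℝ ∞ e e.source)
    (hes : ContDiffOn ℝ ∞ e.symm e.target) :
    IsIntegrableOn (sliceDistribution e) e.target := by
  intro W X Y hW hWt hX hY hXD hYD p hp
  have hF : ContDiffOn ℝ ∞ (fun q => (e.symm q).2) e.target := contDiff_snd.comp_contDiffOn hes
  rw [mem_sliceDistribution_iff he hes (hWt hp)]
  have hXp : DifferentiableAt ℝ X p := (hX.contDiffAt (hW.mem_nhds hp)).differentiableAt (by simp)
  have hYp : DifferentiableAt ℝ Y p := (hY.contDiffAt (hW.mem_nhds hp)).differentiableAt (by simp)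
  have hz : ∀ Z : E → E, (∀ p ∈ W, Z p ∈ sliceDistribution e p) →
      (fun q => fderiv ℝ (fun q => (e.symm q).2) q (Z q)) =ᶠ[𝓝 p] fun _ => 0 := by
    intro Z hZ
    filter_upwards [hW.mem_nhds hp] with q hq
    exact (mem_sliceDistribution_iff he hes (hWt hq) _).1 (hZ q hq)
  have := VectorField.fderiv_apply_lieBracket (𝕜 := ℝ) (n := ∞)
    (hF.contDiffAt (e.open_target.mem_nhds (hWt hp))) minSmoothness_two_le_infty hYp hXp
  rw [this, (hz X hXD).fderiv_eq, (hz Y hYD).fderiv_eq]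
  simp

/-- The coordinate vector fields of `e` in the directions of the slices. -/
noncomputable def sliceFrame (e : OpenPartialHomeomorph (EuclideanSpace ℝ (Fin k) × N) E)
    (i : Fin k) (p : E) : E :=
  fderiv ℝ e (e.symm p) (EuclideanSpace.single i 1, 0)

lemma contDiffOn_sliceFrame (he : ContDiffOn ℝ ∞ e e.source)
    (hes : ContDiffOn ℝ ∞ e.symm e.target) (i : Fin k) :
    ContDiffOn ℝ ∞ (sliceFrame e i) e.target := by
  have h1 : ContDiffOn ℝ ∞ (fderiv ℝ e) e.source := he.fderiv_of_isOpen e.open_source (by simp)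
  exact (h1.comp hes fun p hp => e.map_target hp).clm_apply contDiffOn_const

lemma isSmoothFrameOn_sliceFrame (he : ContDiffOn ℝ ∞ e e.source)
    (hes : ContDiffOn ℝ ∞ e.symm e.target) :
    IsSmoothFrameOn (sliceDistribution e) e.target (sliceFrame e) := by
  refine ⟨contDiffOn_sliceFrame he hes, fun p hp => ?_⟩
  set T : EuclideanSpace ℝ (Fin k) →ₗ[ℝ] E := ((fderiv ℝ e (e.symm p)).comp
    (ContinuousLinearMap.inl ℝ (EuclideanSpace ℝ (Fin k)) N)).toLinearMap with hT
  have hinj : Function.Injective T := by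
    intro v w hvw
    have h1 := OpenPartialHomeomorph.fderiv_symm_fderiv he hes (e.map_target hp) (v, 0)
    have h2 := OpenPartialHomeomorph.fderiv_symm_fderiv he hes (e.map_target hp) (w, 0)
    have h3 : fderiv ℝ e (e.symm p) (v, 0) = fderiv ℝ e (e.symm p) (w, 0) := hvw
    rw [h3, h2] at h1
    exact (congrArg Prod.fst h1).symm
  set b := (EuclideanSpace.basisFun (Fin k) ℝ).toBasis with hb
  have hfr : (fun i => sliceFrame e i p) = T ∘ b := by
    ext1 i
    simp [hb, hT, sliceFrame]
  rw [hfr]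
  refine ⟨b.linearIndependent.map' T (LinearMap.ker_eq_bot.2 hinj), ?_⟩
  rw [range_comp, ← Submodule.map_span, b.span_eq, Submodule.map_top]
  rfl

lemma commuteOn_sliceFrame (he : ContDiffOn ℝ ∞ e e.source)
    (hes : ContDiffOn ℝ ∞ e.symm e.target) : CommuteOn (sliceFrame e) e.target := by
  intro i j p hp
  have hd : ∀ i, DifferentiableAt ℝ (sliceFrame e i) p := fun i =>
    ((contDiffOn_sliceFrame he hes i).contDiffAt (e.open_target.mem_nhds hp)).differentiableAt
      (by simp)
  have hc : ∀ i, (fun q => fderiv ℝ e.symm q (sliceFrame e i q)) =ᶠ[𝓝 p]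
      fun _ => (EuclideanSpace.single i 1, 0) := by
    intro i
    filter_upwards [e.open_target.mem_nhds hp] with q hq
    have := OpenPartialHomeomorph.fderiv_symm_fderiv he hes (e.map_target hq)
      (EuclideanSpace.single i 1, 0)
    rwa [e.right_inv hq] at this
  have h1 := VectorField.fderiv_apply_lieBracket (𝕜 := ℝ) (n := ∞)
    (hes.contDiffAt (e.open_target.mem_nhds hp)) minSmoothness_two_le_infty (hd j) (hd i)
  rw [(hc i).fderiv_eq, (hc j).fderiv_eq] at h1
  have h2 := OpenPartialHomeomorph.fderiv_fderiv_symm he hes hp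
    (VectorField.lieBracket ℝ (sliceFrame e i) (sliceFrame e j) p)
  rw [h1] at h2
  simpa using h2.symm

end Slices

/-! ### The flow of a frame of vector fields -/

section FrameFlow

variable {K E : Type} [NormedAddCommGroup K] [NormedSpace ℝ K] [CompleteSpace K]
  [NormedAddCommGroup E] [NormedSpace ℝ E] [CompleteSpace E]

/-- The flow of a frame: for small `(y, x)`, the curve `Γ (y, x)` on `[0, 1]` starts at `x` and is
an integral curve of the combination `X · y` of the fields of the frame. It depends smoothly
on `(y, x)`; its derivatives solve the linearized equation, and rescaling `y` reparametrizes it. -/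
theorem exists_frame_flow {X : E → K →L[ℝ] E} (hX : ContDiff ℝ ∞ X) {ε : ℝ} (hε : 0 < ε) :
    ∃ r > 0, ∃ Γ : K × E → C(unitInterval, E), ContDiffOn ℝ ∞ Γ (Metric.ball 0 r) ∧ Γ 0 = 0 ∧
      (∀ p ∈ Metric.ball 0 r, ∀ t, ‖Γ p t‖ < ε) ∧
      (∀ p ∈ Metric.ball 0 r, ∃ g : ℝ → E, g 0 = p.2 ∧ (∀ t : unitInterval, g t = Γ p t) ∧
        ∀ t : unitInterval, HasDerivAt g (X (g t) p.1) t) ∧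
      (∀ p ∈ Metric.ball 0 r, ∀ η ξ, ∃ w : ℝ → E, w 0 = ξ ∧
        (∀ t : unitInterval, w t = fderiv ℝ Γ p (η, ξ) t) ∧
        ∀ t : unitInterval, HasDerivAt w (X (Γ p t) η + fderiv ℝ X (Γ p t) (w t) p.1) t) ∧
      ∀ y x, (y, x) ∈ Metric.ball (0 : K × E) r → ∀ t : unitInterval,
        Γ ((t : ℝ) • y, x) 1 = Γ (y, x) t := by
  set f : K × E → E := fun q => X q.2 q.1 with hf
  have hfs : ContDiff ℝ ∞ f := (hX.comp contDiff_snd).clm_apply contDiff_fst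
  obtain ⟨r, hr, ε', hε', Γ, hΓ, hΓ0, hΓp⟩ := exists_smooth_solution hfs (fun x => by simp [hf]) hε
  have hsol : ∀ p ∈ Metric.ball (0 : K × E) r, ∃ g : ℝ → E, g 0 = p.2 ∧
      (∀ t : unitInterval, g t = Γ p t) ∧
      ∀ t : unitInterval, HasDerivAt g (X (g t) p.1) t := by
    intro p hp
    obtain ⟨g, hg0, hgΓ, hg'⟩ := exists_hasDerivAt_of_eq_add_primitive (hΓp p hp).2.2.1
    refine ⟨g, hg0, hgΓ, fun t => ?_⟩
    have := hg' t
    rw [extendLine_coe] at this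
    rw [hgΓ]
    change HasDerivAt g (f (paramCurve K E (p.1, Γ p) t)) t at this
    rwa [paramCurve_apply] at this
  refine ⟨r, hr, Γ, hΓ, hΓ0, fun p hp t => ((Γ p).norm_coe_le_norm t).trans_lt (hΓp p hp).1,
    hsol, ?_, ?_⟩
  · intro p hp η ξ
    set f' : C(K × E, K × E →L[ℝ] E) := ⟨fderiv ℝ f, hfs.continuous_fderiv (by simp)⟩
    have hΓd : HasFDerivAt Γ (fderiv ℝ Γ p) p :=
      ((hΓ.contDiffAt (Metric.isOpen_ball.mem_nhds hp)).differentiableAt (by simp)).hasFDerivAt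
    have hpc : HasFDerivAt (fun q : K × E => paramCurve K E (q.1, Γ q))
        ((paramCurve K E).comp ((ContinuousLinearMap.fst ℝ K E).prod (fderiv ℝ Γ p))) p :=
      (paramCurve K E).hasFDerivAt.comp p (hasFDerivAt_fst.prodMk hΓd)
    have hN := (ContinuousMap.hasFDerivAt_comp (α := unitInterval)
      (⟨f, hfs.continuous⟩ : C(K × E, E)) f'
      (fun x => (hfs.differentiable (by simp) x).hasFDerivAt) (paramCurve K E (p.1, Γ p))).comp p hpc
    have hR := ((constCLM unitInterval E).hasFDerivAt.comp p
      (hasFDerivAt_snd (𝕜 := ℝ) (E := K) (F := E))).add ((primitiveCLM E).hasFDerivAt.comp p hN)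
    have heq : Γ =ᶠ[𝓝 p] fun q => constCLM unitInterval E q.2 + primitiveCLM E
        ((⟨f, hfs.continuous⟩ : C(K × E, E)).comp (paramCurve K E (q.1, Γ q))) := by
      filter_upwards [Metric.isOpen_ball.mem_nhds hp] with q hq using (hΓp q hq).2.2.1
    have hw := DFunLike.congr_fun (hΓd.unique (hR.congr_of_eventuallyEq heq)) (η, ξ)
    obtain ⟨w, hw0, hwΓ, hw'⟩ := exists_hasDerivAt_of_eq_add_primitive
      (γ := fderiv ℝ Γ p (η, ξ)) (x := ξ) hw
    refine ⟨w, hw0, hwΓ, fun t => ?_⟩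
    convert! hw' t using 1
    rw [extendLine_coe, hwΓ]
    have hfd : HasFDerivAt f (((X (Γ p t)).comp (ContinuousLinearMap.fst ℝ K E)) +
        ((fderiv ℝ X (Γ p t)).comp (ContinuousLinearMap.snd ℝ K E)).flip p.1) (p.1, Γ p t) := by
      have h1 : HasFDerivAt X (fderiv ℝ X (Γ p t)) (Γ p t) :=
        (hX.differentiable (by simp) _).hasFDerivAt
      have h2 : HasFDerivAt (fun q : K × E => X q.2)
          ((fderiv ℝ X (Γ p t)).comp (ContinuousLinearMap.snd ℝ K E)) (p.1, Γ p t) :=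
        HasFDerivAt.comp (p.1, Γ p t) (g := X) h1 hasFDerivAt_snd
      exact h2.clm_apply hasFDerivAt_fst
    change _ = fderiv ℝ f (paramCurve K E (p.1, Γ p) t)
      (paramCurve K E (η, fderiv ℝ Γ p (η, ξ)) t)
    rw [paramCurve_apply, paramCurve_apply, hfd.fderiv]
    simp
  · intro y x hp t
    have ht0 : (0 : ℝ) ≤ t := t.2.1
    have ht1 : (t : ℝ) ≤ 1 := t.2.2
    have hp' : ((t : ℝ) • y, x) ∈ Metric.ball (0 : K × E) r := by
      rw [mem_ball_zero_iff, Prod.norm_def] at hp ⊢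
      refine lt_of_le_of_lt (max_le_max ?_ le_rfl) hp
      rw [norm_smul, Real.norm_of_nonneg ht0]
      exact mul_le_of_le_one_left (norm_nonneg _) ht1
    obtain ⟨g, hg0, hgΓ, hg'⟩ := hsol _ hp
    set γ : C(unitInterval, E) :=
      (Γ (y, x)).comp ⟨fun s => t * s, continuous_const.mul continuous_id⟩ with hγ
    have hγg : ∀ s : unitInterval, γ s = g (t * s) := fun s => (hgΓ (t * s)).symm
    have hγn : ‖γ‖ < ε' := by
      refine lt_of_le_of_lt ?_ (hΓp _ hp).2.1
      exact (ContinuousMap.norm_le _ (norm_nonneg _)).2 fun s => (Γ (y, x)).norm_coe_le_norm _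
    have h1 := (hΓp _ hp').2.2.2 γ hγn ?_
    · rw [← h1, hγg, hgΓ t |>.symm]
      simp
    · ext s
      set h : C(unitInterval, E) :=
        (⟨f, hfs.continuous⟩ : C(K × E, E)).comp (paramCurve K E ((t : ℝ) • y, γ)) with hh
      have hd : ∀ s' ∈ uIcc (0 : ℝ) s, HasDerivAt (fun s => g (t * s)) (extendLine h s') s' := by
        intro s' hs'
        rw [uIcc_of_le s.2.1] at hs'
        set s₁ : unitInterval := ⟨s', hs'.1, hs'.2.trans s.2.2⟩
        have h2 : HasDerivAt g (X (g (t * s')) y) (t * s') := hg' (t * s₁)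
        have h3 : HasDerivAt (fun s : ℝ => (t : ℝ) * s) (t : ℝ) s' := by
          simpa using (hasDerivAt_id s').const_mul (t : ℝ)
        convert! h2.scomp s' h3 using 1
        have h4 : extendLine h s' = h s₁ := extendLine_coe h s₁
        rw [h4, hh]
        change f (paramCurve K E ((t : ℝ) • y, γ) s₁) = _
        rw [paramCurve_apply, hγg, hf]
        simp [s₁]
      have h5 := intervalIntegral.integral_eq_sub_of_hasDerivAt hd
        ((continuous_extendLine h).intervalIntegrable _ _)
      rw [hγg, ContinuousMap.add_apply, primitiveCLM_apply, h5, constCLM_apply]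
      simp [hg0]

end FrameFlow

/-! ### Straightening a commuting frame on the convex side -/

section Straightening

variable {K E N : Type} [NormedAddCommGroup K] [NormedSpace ℝ K]
  [NormedAddCommGroup E] [NormedSpace ℝ E] [NormedAddCommGroup N] [NormedSpace ℝ N]

/-- Negative definiteness of a continuously varying bilinear form is an open condition. -/
lemma ContinuousAt.eventually_apply_self_neg [FiniteDimensional ℝ K] {α : Type*}
    [TopologicalSpace α] {q : α → K →L[ℝ] K →L[ℝ] ℝ} {a : α} (hq : ContinuousAt q a)
    (h : ∀ η ≠ 0, q a η η < 0) : ∀ᶠ p in 𝓝 a, ∀ η ≠ 0, q p η η < 0 := by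
  by_cases hne : (Metric.sphere (0 : K) 1).Nonempty
  · obtain ⟨η₀, hη₀, hmax⟩ := (isCompact_sphere (0 : K) 1).exists_isMaxOn hne
      (f := fun η => q a η η) (by fun_prop)
    have hη₀' : η₀ ≠ 0 := by
      rintro rfl
      simp at hη₀
    have hc : 0 < -q a η₀ η₀ := by linarith [h η₀ hη₀']
    filter_upwards [hq.eventually (eventually_norm_sub_lt (q a) hc)] with p hp η hη
    -- by homogeneity it suffices to treat unit vectors
    have hn : 0 < ‖η‖ := norm_pos_iff.2 hη
    set u : K := ‖η‖⁻¹ • η with hu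
    have hun : ‖u‖ = 1 := by
      rw [hu, norm_smul, norm_inv, norm_norm, inv_mul_cancel₀ hn.ne']
    have hηu : η = ‖η‖ • u := by
      rw [hu, smul_smul, mul_inv_cancel₀ hn.ne', one_smul]
    have h1 : q a u u ≤ q a η₀ η₀ := hmax (by simpa using hun)
    have h2 : ‖(q p - q a) u u‖ ≤ ‖q p - q a‖ := by
      have := (q p - q a).le_opNorm₂ u u
      rwa [hun, mul_one, mul_one] at this
    have h3 : q p u u < 0 := by
      have h4 := (abs_le.1 (Real.norm_eq_abs _ ▸ h2)).2
      simp only [sub_apply] at h4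
      linarith
    have h5 : q p η η = ‖η‖ * (‖η‖ * q p u u) := by
      conv_lhs => rw [hηu]
      simp only [map_smul, smul_apply, smul_eq_mul]
    rw [h5]
    exact mul_neg_of_pos_of_neg hn (mul_neg_of_pos_of_neg hn h3)
  · refine Filter.Eventually.of_forall fun p η hη => (hne ⟨‖η‖⁻¹ • η, ?_⟩).elim
    have hn : ‖η‖ ≠ 0 := norm_ne_zero_iff.2 hη
    rw [mem_sphere_zero_iff_norm, norm_smul, norm_inv, norm_norm, inv_mul_cancel₀ hn]

/-- Along an integral curve that starts at a critical point and along which `ρ` is strictly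
concave, `ρ` is larger than at the endpoint. -/
lemma lt_of_strictly_concave_along_curve {X : E → K →L[ℝ] E} (hX : ContDiff ℝ ∞ X) {U : Set E}
    (hU : IsOpen U) {ρ : E → ℝ} (hρ : ContDiffOn ℝ ∞ ρ U) {g : ℝ → E} {y : K}
    (hg : ∀ t ∈ Icc (0 : ℝ) 1, HasDerivAt g (X (g t) y) t) (hgU : ∀ t ∈ Icc (0 : ℝ) 1, g t ∈ U)
    (h0 : fderiv ℝ ρ (g 0) (X (g 0) y) = 0)
    (hneg : ∀ t ∈ Icc (0 : ℝ) 1,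
      fderiv ℝ (fun p => (fderiv ℝ ρ p).comp (X p)) (g t) (X (g t) y) y < 0)
    {t : ℝ} (ht : t ∈ Ico (0 : ℝ) 1) : ρ (g 1) < ρ (g t) := by
  have hS : ContDiffOn ℝ ∞ (fun p => (fderiv ℝ ρ p).comp (X p)) U :=
    (hρ.fderiv_of_isOpen hU (by simp)).clm_comp hX.contDiffOn
  have h1 : ∀ t ∈ Icc (0 : ℝ) 1,
      HasDerivAt (fun t => ρ (g t)) (fderiv ℝ ρ (g t) (X (g t) y)) t := fun t ht =>
    (((hρ.contDiffAt (hU.mem_nhds (hgU t ht))).differentiableAt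
      (by simp)).hasFDerivAt).comp_hasDerivAt t (hg t ht)
  have h2 : ∀ t ∈ Icc (0 : ℝ) 1, HasDerivAt (fun t => fderiv ℝ ρ (g t) (X (g t) y))
      (fderiv ℝ (fun p => (fderiv ℝ ρ p).comp (X p)) (g t) (X (g t) y) y) t := fun t ht => by
    have h3 := (((hS.contDiffAt (hU.mem_nhds (hgU t ht))).differentiableAt
      (by simp)).hasFDerivAt).comp_hasDerivAt t (hg t ht)
    simpa using h3.clm_apply (hasDerivAt_const t y)
  have h3 : StrictAntiOn (fun t => fderiv ℝ ρ (g t) (X (g t) y)) (Icc 0 1) := by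
    refine strictAntiOn_of_deriv_neg (convex_Icc 0 1)
      (fun t ht => (h2 t ht).continuousAt.continuousWithinAt) fun t ht => ?_
    have ht' := interior_subset ht
    rw [(h2 t ht').deriv]
    exact hneg t ht'
  have h4 : StrictAntiOn (fun t => ρ (g t)) (Icc 0 1) := by
    refine strictAntiOn_of_deriv_neg (convex_Icc 0 1)
      (fun t ht => (h1 t ht).continuousAt.continuousWithinAt) fun t ht => ?_
    rw [interior_Icc] at ht
    rw [(h1 t (Ioo_subset_Icc_self ht)).deriv, ← h0]
    exact h3 (left_mem_Icc.2 zero_le_one) (Ioo_subset_Icc_self ht) ht.1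
  exact h4 (Ico_subset_Icc_self ht) (right_mem_Icc.2 zero_le_one) ht.2

/-- Solutions of the linearized equation along an integral curve of `X · y`, in the direction of
the parameter `η`: where the frame commutes, the solution is `t X η`. -/
lemma jacobi_field_eq {X : E → K →L[ℝ] E} (hX : ContDiff ℝ ∞ X) {g w : ℝ → E} {y η : K}
    (hg : ∀ t ∈ Icc (0 : ℝ) 1, HasDerivAt g (X (g t) y) t)
    (hw : ∀ t ∈ Icc (0 : ℝ) 1, HasDerivAt w (X (g t) η + fderiv ℝ X (g t) (w t) y) t)
    (hw0 : w 0 = 0)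
    (hcomm : ∀ t ∈ Ico (0 : ℝ) 1,
      fderiv ℝ X (g t) (X (g t) y) η = fderiv ℝ X (g t) (X (g t) η) y) :
    w 1 = X (g 1) η := by
  -- the difference `u = w - t X η` solves the homogeneous linear equation `u' = (DX u) y`
  set u : ℝ → E := fun t => w t - t • X (g t) η with hu
  have hXg : ∀ t ∈ Icc (0 : ℝ) 1,
      HasDerivAt (fun t => X (g t) η) (fderiv ℝ X (g t) (X (g t) y) η) t := fun t ht => by
    have h3 := ((hX.differentiable (by simp) (g t)).hasFDerivAt).comp_hasDerivAt t (hg t ht)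
    simpa using h3.clm_apply (hasDerivAt_const t η)
  have hu' : ∀ t ∈ Icc (0 : ℝ) 1, HasDerivAt u (X (g t) η + fderiv ℝ X (g t) (w t) y -
      (t • fderiv ℝ X (g t) (X (g t) y) η + (1 : ℝ) • X (g t) η)) t := fun t ht =>
    (hw t ht).sub ((hasDerivAt_id t).smul (hXg t ht))
  have hgc : ContinuousOn g (Icc 0 1) := fun t ht => (hg t ht).continuousAt.continuousWithinAt
  obtain ⟨C, hC⟩ := isCompact_Icc.exists_bound_of_continuousOn
    ((hX.continuous_fderiv (by simp)).comp_continuousOn hgc)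
  have h0 := eq_zero_of_abs_deriv_le_mul_abs_self_of_eq_zero_right (K := C * ‖y‖)
    (fun t ht => (hu' t ht).continuousAt.continuousWithinAt)
    (fun t ht => (hu' t (Ico_subset_Icc_self ht)).hasDerivWithinAt)
    (by simp [hu, hw0]) (fun t ht => by
      have h1 : X (g t) η + fderiv ℝ X (g t) (w t) y -
          (t • fderiv ℝ X (g t) (X (g t) y) η + (1 : ℝ) • X (g t) η) =
          fderiv ℝ X (g t) (u t) y := by
        rw [hcomm t ht, hu]
        simp only [map_sub, map_smul, sub_apply, smul_apply, one_smul]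
        abel
      rw [h1]
      calc ‖fderiv ℝ X (g t) (u t) y‖ ≤ ‖fderiv ℝ X (g t)‖ * ‖u t‖ * ‖y‖ :=
            (fderiv ℝ X (g t)).le_opNorm₂ (u t) y
        _ ≤ C * ‖u t‖ * ‖y‖ := by
            gcongr
            exact hC t (Ico_subset_Icc_self ht)
        _ = C * ‖y‖ * ‖u t‖ := by ring) 1 (right_mem_Icc.2 zero_le_one)
  simpa [hu, sub_eq_zero] using h0

/-- An injective linear map between finite-dimensional spaces of the same dimension, as an
equivalence. -/
lemma ContinuousLinearMap.exists_equiv_of_injective [FiniteDimensional ℝ E] [FiniteDimensional ℝ N]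
    (f : E →L[ℝ] N) (hf : Function.Injective f)
    (hdim : Module.finrank ℝ E = Module.finrank ℝ N) : ∃ f' : E ≃L[ℝ] N, (f' : E →L[ℝ] N) = f :=
  ⟨(LinearMap.linearEquivOfInjective f.toLinearMap hf hdim).toContinuousLinearEquiv, rfl⟩

variable [FiniteDimensional ℝ E]

lemma finrank_eq_add_of_ker_eq_range {f : K →L[ℝ] E} (hf : Function.Injective f) {π : E →L[ℝ] N}
    (hπ : Function.Surjective π) (hker : ∀ v, π v = 0 ↔ v ∈ range f) :
    Module.finrank ℝ E = Module.finrank ℝ K + Module.finrank ℝ N := by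
  have h1 := LinearMap.finrank_range_add_finrank_ker π.toLinearMap
  have h2 : LinearMap.ker π.toLinearMap = LinearMap.range f.toLinearMap := by
    ext v
    exact hker v
  rw [h2, LinearMap.finrank_range_of_inj (f := f.toLinearMap) hf,
    LinearMap.range_eq_top.2 (show Function.Surjective π.toLinearMap from hπ), finrank_top] at h1
  omega

variable [FiniteDimensional ℝ K] [FiniteDimensional ℝ N]

/-- The zero set of a map `S` to the dual space which is nondegenerate in the directions of the
kernel of `π` is, locally, the graph of a smooth map over the range of `π`. -/
lemma exists_transversal {S : E → K →L[ℝ] ℝ} {U : Set E} (hU : IsOpen U) (h0U : 0 ∈ U)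
    (hS : ContDiffOn ℝ ∞ S U) (hS0 : S 0 = 0) {f : K →L[ℝ] E} (hf : Function.Injective f)
    (hneg : ∀ η ≠ 0, fderiv ℝ S 0 (f η) η < 0) {π : E →L[ℝ] N}
    (hπ : Function.Surjective π) (hker : ∀ v, π v = 0 ↔ v ∈ range f) :
    ∃ (B : Set N) (σ : N → E), IsOpen B ∧ 0 ∈ B ∧ ContDiffOn ℝ ∞ σ B ∧ σ 0 = 0 ∧
      ∀ c ∈ B, S (σ c) = 0 ∧ π (σ c) = c := by
  set Θ : E → (K →L[ℝ] ℝ) × N := fun p => (S p, π p) with hΘ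
  have hΘs : ContDiffOn ℝ ∞ Θ U := hS.prodMk π.contDiff.contDiffOn
  have hΘd : HasFDerivAt Θ ((fderiv ℝ S 0).prod π) 0 :=
    ((hS.contDiffAt (hU.mem_nhds h0U)).differentiableAt (by simp)).hasFDerivAt.prodMk
      π.hasFDerivAt
  obtain ⟨Θ', hΘ'⟩ := ((fderiv ℝ S 0).prod π).exists_equiv_of_injective (by
    rw [injective_iff_map_eq_zero]
    intro v hv
    obtain ⟨η, rfl⟩ := (hker v).1 (congrArg Prod.snd hv)
    by_contra hne
    have hη : η ≠ 0 := by
      rintro rfl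
      exact hne (map_zero f)
    have h1 : fderiv ℝ S 0 (f η) = 0 := congrArg Prod.fst hv
    have h2 := hneg η hη
    rw [h1] at h2
    exact lt_irrefl _ h2) (by
    rw [finrank_eq_add_of_ker_eq_range hf hπ hker, Module.finrank_prod,
      ← (LinearMap.toContinuousLinearMap (𝕜 := ℝ) (E := K) (F' := ℝ)).finrank_eq]
    congr 1
    exact (Subspace.dual_finrank_eq).symm)
  rw [← hΘ'] at hΘd
  obtain ⟨e, he, h0e, heU, hes⟩ := exists_smooth_openPartialHomeomorph hU h0U hΘs hΘd
  have hΘ0 : e 0 = ((0, 0) : (K →L[ℝ] ℝ) × N) := by rw [he, hΘ]; simp [hS0]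
  have hin : Continuous fun c : N => ((0, c) : (K →L[ℝ] ℝ) × N) := by fun_prop
  refine ⟨(fun c : N => ((0, c) : (K →L[ℝ] ℝ) × N)) ⁻¹' e.target, fun c => e.symm (0, c),
    e.open_target.preimage hin, ?_, ?_, ?_, ?_⟩
  · rw [mem_preimage, ← hΘ0]; exact e.map_source h0e
  · exact hes.comp (contDiff_const.prodMk contDiff_id).contDiffOn fun c hc => hc
  · change e.symm (0, 0) = 0
    rw [← hΘ0, e.left_inv h0e]
  · intro c hc
    have h1 : Θ (e.symm (0, c)) = (0, c) := by rw [← he]; exact e.right_inv hc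
    exact ⟨congrArg Prod.fst h1, congrArg Prod.snd h1⟩

end Straightening

/-! ### A chart adapted to the frame and to the hypersurface -/

section StraighteningChart

variable {k : ℕ} {E N : Type} [NormedAddCommGroup E] [NormedSpace ℝ E] [FiniteDimensional ℝ E]
  [NormedAddCommGroup N] [NormedSpace ℝ N] [FiniteDimensional ℝ N]

/-- A frame which commutes where `ρ > 0`, and along which `ρ` is strictly concave at a critical
point, has a chart whose first coordinates straighten it where `ρ ≥ 0`, and whose slices meet
`ρ > 0` in connected sets. -/
theorem exists_straightening_chart {X : E → EuclideanSpace ℝ (Fin k) →L[ℝ] E}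
    (hX : ContDiff ℝ ∞ X) {U : Set E} (hU : IsOpen U) (h0U : 0 ∈ U) {ρ : E → ℝ}
    (hρ : ContDiffOn ℝ ∞ ρ U)
    (hcomm : ∀ p ∈ U, 0 < ρ p → ∀ η ξ, fderiv ℝ X p (X p ξ) η = fderiv ℝ X p (X p η) ξ)
    (hinj : Function.Injective (X 0)) (hcrit : (fderiv ℝ ρ 0).comp (X 0) = 0)
    (hneg : ∀ η ≠ 0, fderiv ℝ (fun p => (fderiv ℝ ρ p).comp (X p)) 0 (X 0 η) η < 0)
    {π : E →L[ℝ] N} (hπ : Function.Surjective π) (hker : ∀ v, π v = 0 ↔ v ∈ range (X 0)) :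
    ∃ e : OpenPartialHomeomorph (EuclideanSpace ℝ (Fin k) × N) E,
      ContDiffOn ℝ ∞ e e.source ∧ ContDiffOn ℝ ∞ e.symm e.target ∧ 0 ∈ e.target ∧
      e.target ⊆ U ∧
      (∀ p ∈ e.target, 0 ≤ ρ p → ∀ η, fderiv ℝ e (e.symm p) (η, 0) = X p η) ∧
      (∀ c, IsPreconnected (sliceDomain e e.target c)) ∧
      ∀ c, IsPreconnected (sliceDomain e (e.target ∩ {p | 0 < ρ p}) c) := by
  set S : E → EuclideanSpace ℝ (Fin k) →L[ℝ] ℝ := fun p => (fderiv ℝ ρ p).comp (X p) with hS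
  have hSs : ContDiffOn ℝ ∞ S U := (hρ.fderiv_of_isOpen hU (by simp)).clm_comp hX.contDiffOn
  have hq : ContinuousAt (fun p => (fderiv ℝ S p).comp (X p)) 0 :=
    ((hSs.continuousOn_fderiv_of_isOpen hU (by simp)).continuousAt (hU.mem_nhds h0U)).clm_comp
      hX.continuous.continuousAt
  obtain ⟨ε, hε, hεball⟩ := Metric.eventually_nhds_iff_ball.1
    ((hq.eventually_apply_self_neg hneg).and (hU.mem_nhds h0U))
  obtain ⟨B, σ, hB, h0B, hσ, hσ0, hσB⟩ := exists_transversal hU h0U hSs hcrit hinj hneg hπ hker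
  obtain ⟨r, hr, Γ, hΓ, hΓ0, hΓε, hsol, hjac, hscale⟩ := exists_frame_flow hX hε
  set B' : Set (EuclideanSpace ℝ (Fin k) × N) :=
    (univ ×ˢ B) ∩ (fun q => (q.1, σ q.2)) ⁻¹' Metric.ball 0 r with hB'
  have hσ' : ContinuousOn (fun q : EuclideanSpace ℝ (Fin k) × N => (q.1, σ q.2)) (univ ×ˢ B) :=
    continuousOn_fst.prodMk (hσ.continuousOn.comp continuousOn_snd fun q hq => hq.2)
  have hB'o : IsOpen B' := hσ'.isOpen_inter_preimage (isOpen_univ.prod hB) Metric.isOpen_ball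
  have h0B' : (0 : EuclideanSpace ℝ (Fin k) × N) ∈ B' := by
    refine ⟨⟨mem_univ _, h0B⟩, ?_⟩
    simp [hσ0, hr]
  -- the chart: flow for unit time from the transversal `σ`
  set Φ : EuclideanSpace ℝ (Fin k) × N → E := fun q => Γ (q.1, σ q.2) 1 with hΦ
  have hΦd : ∀ q ∈ B', HasFDerivAt Φ ((ContinuousMap.evalCLM ℝ (1 : unitInterval)).comp
      ((fderiv ℝ Γ (q.1, σ q.2)).comp ((ContinuousLinearMap.fst ℝ _ N).prod
        ((fderiv ℝ σ q.2).comp (ContinuousLinearMap.snd ℝ _ N))))) q := by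
    intro q hq
    have h1 : HasFDerivAt σ (fderiv ℝ σ q.2) q.2 :=
      ((hσ.contDiffAt (hB.mem_nhds hq.1.2)).differentiableAt (by simp)).hasFDerivAt
    have h2 : HasFDerivAt Γ (fderiv ℝ Γ (q.1, σ q.2)) (q.1, σ q.2) :=
      ((hΓ.contDiffAt (Metric.isOpen_ball.mem_nhds hq.2)).differentiableAt (by simp)).hasFDerivAt
    have h3 := hasFDerivAt_fst.prodMk (h1.comp q (hasFDerivAt_snd (𝕜 := ℝ)
      (E := EuclideanSpace ℝ (Fin k)) (F := N)))
    exact (ContinuousMap.evalCLM ℝ (1 : unitInterval)).hasFDerivAt.comp q (h2.comp q h3)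
  have hΦs : ContDiffOn ℝ ∞ Φ B' := by
    refine (ContinuousMap.evalCLM ℝ (1 : unitInterval)).contDiff.comp_contDiffOn
      (hΓ.comp (contDiff_fst.contDiffOn.prodMk (hσ.comp contDiff_snd.contDiffOn ?_)) ?_)
    · exact fun q hq => hq.1.2
    · exact fun q hq => hq.2
  have hΦ0 : Φ 0 = 0 := by
    change Γ (0, σ 0) 1 = 0
    rw [hσ0]
    change Γ 0 1 = 0
    rw [hΓ0]; rfl
  have hσd : ∀ ζ, π (fderiv ℝ σ 0 ζ) = ζ := by
    intro ζ
    have h1 : HasFDerivAt σ (fderiv ℝ σ 0) 0 :=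
      ((hσ.contDiffAt (hB.mem_nhds h0B)).differentiableAt (by simp)).hasFDerivAt
    have h2 := π.hasFDerivAt.comp (0 : N) h1
    have h3 : (π ∘ σ) =ᶠ[𝓝 0] id := by
      filter_upwards [hB.mem_nhds h0B] with c hc using (hσB c hc).2
    exact DFunLike.congr_fun (h2.unique ((hasFDerivAt_id 0).congr_of_eventuallyEq h3)) ζ
  have hΓd0 : ∀ η ξ, fderiv ℝ Γ 0 (η, ξ) 1 = ξ + X 0 η := by
    intro η ξ
    obtain ⟨w, hw0, hwΓ, hw⟩ := hjac 0 (Metric.mem_ball_self hr) η ξ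
    have h1 : ∀ t ∈ uIcc (0 : ℝ) 1, HasDerivAt w (X 0 η) t := by
      intro t ht
      rw [uIcc_of_le zero_le_one] at ht
      have := hw ⟨t, ht⟩
      rw [hΓ0] at this
      simpa using this
    have h2 := intervalIntegral.integral_eq_sub_of_hasDerivAt h1 intervalIntegrable_const
    rw [hw0, show w 1 = _ from hwΓ 1] at h2
    simp only [intervalIntegral.integral_const, sub_zero, one_smul] at h2
    rw [h2]; abel
  obtain ⟨Φ', hΦ'⟩ := (((ContinuousMap.evalCLM ℝ (1 : unitInterval)).comp
      ((fderiv ℝ Γ ((0 : EuclideanSpace ℝ (Fin k) × N).1,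
        σ (0 : EuclideanSpace ℝ (Fin k) × N).2)).comp ((ContinuousLinearMap.fst ℝ _ N).prod
        ((fderiv ℝ σ (0 : EuclideanSpace ℝ (Fin k) × N).2).comp
          (ContinuousLinearMap.snd ℝ _ N)))))).exists_equiv_of_injective (by
    rw [injective_iff_map_eq_zero]
    rintro ⟨η, ζ⟩ hv
    have h0 : ((0 : EuclideanSpace ℝ (Fin k) × N).1,
        σ (0 : EuclideanSpace ℝ (Fin k) × N).2) = 0 := by
      change (_, σ 0) = _
      rw [hσ0]; rfl
    rw [h0] at hv
    have h1 : fderiv ℝ σ 0 ζ + X 0 η = 0 := (hΓd0 η (fderiv ℝ σ 0 ζ)).symm.trans hv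
    have h2 := congrArg π h1
    rw [map_add, hσd, (hker _).2 (mem_range_self η), add_zero, map_zero] at h2
    rw [h2, map_zero, zero_add] at h1
    rw [h2, (injective_iff_map_eq_zero _).1 hinj η h1]
    rfl) (by rw [finrank_eq_add_of_ker_eq_range hinj hπ hker, Module.finrank_prod])
  have hΦd0 := hΦd 0 h0B'
  rw [← hΦ'] at hΦd0
  obtain ⟨e₀, he₀, h0e₀, he₀B, he₀s⟩ :=
    exists_smooth_openPartialHomeomorph hB'o h0B' hΦs hΦd0
  -- on a ball around the origin, the slices are convex and invariant under scaling of `y`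
  obtain ⟨r₁, hr₁, hr₁e⟩ := Metric.isOpen_iff.1 e₀.open_source 0 h0e₀
  set e := e₀.restrOpen (Metric.ball 0 r₁) Metric.isOpen_ball with he
  have hee : ∀ q, e q = Φ q := fun q => congrFun he₀ q
  have hsrc : e.source = Metric.ball 0 r₁ := inter_eq_right.2 hr₁e
  have hsB : ∀ q ∈ e.source, q ∈ B' := fun q hq => he₀B hq.1
  have h0s : (0 : EuclideanSpace ℝ (Fin k) × N) ∈ e.source := by
    rw [hsrc]; exact Metric.mem_ball_self hr₁
  -- the curve through a point of the chart stays in the region where `ρ` is concave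
  have hcurve : ∀ y c, (y, c) ∈ e.source → ∃ g : ℝ → E,
      (∀ t : unitInterval, g t = Γ (y, σ c) t) ∧
      (∀ t ∈ Icc (0 : ℝ) 1, HasDerivAt g (X (g t) y) t) ∧ (∀ t ∈ Icc (0 : ℝ) 1, g t ∈ U) ∧
      (y ≠ 0 → ∀ t ∈ Ico (0 : ℝ) 1, ρ (g 1) < ρ (g t)) := by
    intro y c hyc
    have hmem := hsB _ hyc
    obtain ⟨g, hg0, hgΓ, hg⟩ := hsol _ hmem.2
    have hg' : ∀ t ∈ Icc (0 : ℝ) 1, HasDerivAt g (X (g t) y) t := fun t ht => hg ⟨t, ht⟩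
    have hgε : ∀ t ∈ Icc (0 : ℝ) 1, g t ∈ Metric.ball 0 ε := fun t ht => by
      rw [mem_ball_zero_iff, show g t = _ from hgΓ ⟨t, ht⟩]
      exact hΓε _ hmem.2 _
    refine ⟨g, hgΓ, hg', fun t ht => (hεball _ (hgε t ht)).2, fun hy t ht => ?_⟩
    refine lt_of_strictly_concave_along_curve hX hU hρ hg'
      (fun t ht => (hεball _ (hgε t ht)).2) ?_ (fun t ht => (hεball _ (hgε t ht)).1 y hy) ht
    rw [hg0]
    exact DFunLike.congr_fun (hσB c hmem.1.2).1 y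
  have hscale' : ∀ y c, (y, c) ∈ e.source → ∀ t ∈ Icc (0 : ℝ) 1, (t • y, c) ∈ e.source := by
    intro y c hyc t ht
    rw [hsrc, mem_ball_zero_iff, Prod.norm_def] at hyc ⊢
    refine lt_of_le_of_lt (max_le_max ?_ le_rfl) hyc
    rw [norm_smul, Real.norm_of_nonneg ht.1]
    exact mul_le_of_le_one_left (norm_nonneg _) ht.2
  refine ⟨e, ?_, ?_, ?_, ?_, ?_, fun c => ?_, fun c => ?_⟩
  · exact (hΦs.congr fun q _ => hee q).mono hsB
  · exact he₀s.mono fun p hp => hp.1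
  · rw [← hΦ0, ← hee]; exact e.map_source h0s
  · intro p hp
    have hq := e.map_target hp
    obtain ⟨g, hgΓ, -, hgU, -⟩ := hcurve (e.symm p).1 (e.symm p).2 hq
    have h1 : g 1 = p := by
      rw [show g 1 = _ from hgΓ 1]
      exact (hee _).symm.trans (e.right_inv hp)
    rw [← h1]
    exact hgU 1 (right_mem_Icc.2 zero_le_one)
  · intro p hp hρp η
    have hq := e.map_target hp
    obtain ⟨g, hgΓ, hg, hgU, hgρ⟩ := hcurve (e.symm p).1 (e.symm p).2 hq
    have h1 : g 1 = p := by
      rw [show g 1 = _ from hgΓ 1]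
      exact (hee _).symm.trans (e.right_inv hp)
    obtain ⟨w, hw0, hwΓ, hw⟩ := hjac _ (hsB _ hq).2 η 0
    -- the derivative of the flow in the direction of `y` is a Jacobi field
    have hew : fderiv ℝ e (e.symm p) (η, 0) = w 1 := by
      have h2 : (e : EuclideanSpace ℝ (Fin k) × N → E) = Φ := funext hee
      rw [h2, (hΦd _ (hsB _ hq)).fderiv, show w 1 = _ from hwΓ 1]
      simp
    rw [hew, ← h1]
    refine jacobi_field_eq (y := (e.symm p).1) hX hg (fun t ht => ?_) hw0 fun t ht => ?_
    · have := hw ⟨t, ht⟩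
      rwa [← hgΓ] at this
    · by_cases hy : (e.symm p).1 = 0
      · rw [hy]; simp
      · refine hcomm _ (hgU t (Ico_subset_Icc_self ht)) ?_ _ _
        have := hgρ hy t ht
        rw [h1] at this
        exact hρp.trans_lt this
  · have : sliceDomain e e.target c = (fun y => (y, c)) ⁻¹' Metric.ball 0 r₁ := by
      ext y
      rw [mem_preimage, ← hsrc]
      exact ⟨fun h => h.1, fun h => ⟨h, e.map_source h⟩⟩
    rw [this]
    refine Convex.isPreconnected fun y hy z hz a b ha hb hab => ?_
    have h1 := convex_ball (0 : EuclideanSpace ℝ (Fin k) × N) r₁ hy hz ha hb hab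
    rw [mem_preimage]
    convert! h1 using 1
    refine Prod.ext rfl ?_
    change c = a • c + b • c
    rw [← add_smul, hab, one_smul]
  · by_cases hne : (sliceDomain e (e.target ∩ {p | 0 < ρ p}) c).Nonempty
    swap
    · rw [not_nonempty_iff_eq_empty.1 hne]; exact isPreconnected_empty
    have hstar : StarConvex ℝ (0 : EuclideanSpace ℝ (Fin k))
        (sliceDomain e (e.target ∩ {p | 0 < ρ p}) c) := by
      rw [starConvex_zero_iff]
      rintro y ⟨hyc, hyt, hyρ⟩ t ht0 ht1
      have htc := hscale' y c hyc t ⟨ht0, ht1⟩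
      refine ⟨htc, e.map_source htc, ?_⟩
      by_cases hy : y = 0
      · rw [hy, smul_zero, ← hy]; exact hyρ
      · obtain ⟨g, hgΓ, hg, hgU, hgρ⟩ := hcurve y c hyc
        have h1 : e (t • y, c) = g t := by
          rw [hee, show g t = _ from hgΓ ⟨t, ht0, ht1⟩]
          exact hscale y (σ c) (hsB _ hyc).2 ⟨t, ht0, ht1⟩
        have h2 : e (y, c) = g 1 := by
          rw [hee, show g 1 = _ from hgΓ 1]
        rw [h2] at hyρ
        rw [h1]
        rcases eq_or_lt_of_le ht1 with rfl | hlt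
        · exact hyρ
        · exact lt_trans (show (0 : ℝ) < ρ (g 1) from hyρ) (hgρ hy t ⟨ht0, hlt⟩)
    exact (hstar.isPathConnected (starConvex_zero_iff.1 hstar |> fun h => by
      obtain ⟨y, hy⟩ := hne
      simpa using h hy le_rfl zero_le_one)).isConnected.isPreconnected

end StraighteningChart

/-! ### Frames as families of linear maps -/

section Frames

variable {k : ℕ} {E : Type*} [NormedAddCommGroup E] [NormedSpace ℝ E]

/-- A family of `k` vector fields as a field of linear maps on `ℝᵏ`, sending the standard basis to
the given fields. -/
noncomputable def frameMap (Y : Fin k → E → E) (p : E) : EuclideanSpace ℝ (Fin k) →L[ℝ] E :=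
  ∑ i, (EuclideanSpace.proj i : EuclideanSpace ℝ (Fin k) →L[ℝ] ℝ).smulRight (Y i p)

lemma frameMap_single (Y : Fin k → E → E) (p : E) (i : Fin k) :
    frameMap Y p (EuclideanSpace.single i 1) = Y i p := by
  simp [frameMap]

lemma contDiffOn_frameMap {Y : Fin k → E → E} {S : Set E} (hY : ∀ i, ContDiffOn ℝ ∞ (Y i) S) :
    ContDiffOn ℝ ∞ (frameMap Y) S :=
  ContDiffOn.sum fun i _ => (ContinuousLinearMap.smulRightL ℝ (EuclideanSpace ℝ (Fin k)) E
    (EuclideanSpace.proj i)).contDiff.comp_contDiffOn (hY i)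

lemma ContinuousLinearMap.apply_eq_sum_single {F : Type*} [NormedAddCommGroup F] [NormedSpace ℝ F]
    (L : EuclideanSpace ℝ (Fin k) →L[ℝ] F) (η : EuclideanSpace ℝ (Fin k)) :
    L η = ∑ i, η i • L (EuclideanSpace.single i 1) := by
  conv_lhs => rw [← (EuclideanSpace.basisFun (Fin k) ℝ).sum_repr η]
  simp

lemma ContinuousLinearMap.ext_single {F : Type*} [NormedAddCommGroup F] [NormedSpace ℝ F]
    {L L' : EuclideanSpace ℝ (Fin k) →L[ℝ] F}
    (h : ∀ i, L (EuclideanSpace.single i 1) = L' (EuclideanSpace.single i 1)) : L = L' := by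
  refine ContinuousLinearMap.ext fun η => ?_
  rw [L.apply_eq_sum_single, L'.apply_eq_sum_single]
  simp_rw [h]

lemma ContinuousLinearMap.span_range_single (L : EuclideanSpace ℝ (Fin k) →L[ℝ] E) :
    Submodule.span ℝ (range fun i => L (EuclideanSpace.single i 1)) =
      LinearMap.range L.toLinearMap := by
  ext v
  rw [Submodule.mem_span_range_iff_exists_fun]
  constructor
  · rintro ⟨c, rfl⟩
    exact ⟨WithLp.toLp 2 c, L.apply_eq_sum_single _⟩
  · rintro ⟨η, rfl⟩
    exact ⟨η, (L.apply_eq_sum_single η).symm⟩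

lemma ContinuousLinearMap.linearIndependent_single_iff (L : EuclideanSpace ℝ (Fin k) →L[ℝ] E) :
    LinearIndependent ℝ (fun i => L (EuclideanSpace.single i 1)) ↔ Function.Injective L := by
  rw [Fintype.linearIndependent_iff, injective_iff_map_eq_zero]
  constructor
  · intro h η hη
    rw [L.apply_eq_sum_single] at hη
    ext i
    exact h η hη i
  · intro h c hc i
    have := h (WithLp.toLp 2 c) ((L.apply_eq_sum_single _).trans hc)
    exact congrFun (congrArg WithLp.ofLp this) i

lemma IsSmoothFrameOn.frameMap_injective {D : E → Submodule ℝ E} {S : Set E} {Y : Fin k → E → E}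
    (hY : IsSmoothFrameOn D S Y) {p : E} (hp : p ∈ S) : Function.Injective (frameMap Y p) := by
  rw [← ContinuousLinearMap.linearIndependent_single_iff]
  simp_rw [frameMap_single]
  exact (hY.2 p hp).1

lemma IsSmoothFrameOn.range_frameMap {D : E → Submodule ℝ E} {S : Set E} {Y : Fin k → E → E}
    (hY : IsSmoothFrameOn D S Y) {p : E} (hp : p ∈ S) :
    LinearMap.range (frameMap Y p).toLinearMap = D p := by
  rw [← ContinuousLinearMap.span_range_single]
  simp_rw [frameMap_single]
  exact (hY.2 p hp).2

end Frames

/-! ### Extension of the distribution -/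

section Core

lemma positiveSide_union_hypersurface {E : Type*} (U : Set E) (ρ : E → ℝ) [NormedAddCommGroup E]
    [InnerProductSpace ℝ E] :
    positiveSide U ρ ∪ hypersurface U ρ = {p | p ∈ U ∧ 0 ≤ ρ p} := by
  ext p
  simp only [positiveSide, hypersurface, mem_union, mem_ofPred_eq]
  rw [le_iff_lt_or_eq, and_or_left, eq_comm (a := (0 : ℝ))]

variable {k : ℕ} {E : Type} [NormedAddCommGroup E] [InnerProductSpace ℝ E]
  {U : Set E} {ρ : E → ℝ} {D : E → Submodule ℝ E}

/-- A function whose derivative at a point of a hypersurface vanishes from one side has zero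
derivative there, as the directions that point to this side span the space. -/
lemma eq_zero_of_hasFDerivWithinAt_nonneg {F : Type*} [NormedAddCommGroup F] [NormedSpace ℝ F]
    (hU : IsOpen U) (h0U : 0 ∈ U) (hρ : IsDefiningFunction U ρ) (hρ0 : ρ 0 = 0) {f : E → F}
    {A : E →L[ℝ] F} (hA : HasFDerivAt f A 0)
    (hf : HasFDerivWithinAt f (0 : E →L[ℝ] F) {p | p ∈ U ∧ 0 ≤ ρ p} 0) : A = 0 := by
  set ℓ := fderiv ℝ ρ 0
  have hρd : HasFDerivAt ρ ℓ 0 :=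
    ((hρ.1.contDiffAt (hU.mem_nhds h0U)).differentiableAt (by simp)).hasFDerivAt
  -- the ray in a direction with `dρ > 0` starts inside the domain
  have key : ∀ v, 0 < ℓ v → A v = 0 := by
    intro v hv
    have hline : HasDerivAt (fun t : ℝ => t • v) v 0 := by
      simpa using (hasDerivAt_id (0 : ℝ)).smul_const v
    have h1 : HasDerivAt (fun t : ℝ => f (t • v)) (A v) 0 :=
      HasFDerivAt.comp_hasDerivAt (0 : ℝ) (l := f) (by simpa using hA) hline
    have h2 : HasDerivAt (fun t : ℝ => ρ (t • v)) (ℓ v) 0 :=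
      HasFDerivAt.comp_hasDerivAt (0 : ℝ) (l := ρ) (by simpa using hρd) hline
    set s : Set ℝ := {t | t • v ∈ {p | p ∈ U ∧ 0 ≤ ρ p}}
    have hs : s ∈ 𝓝[Ici 0] (0 : ℝ) := by
      have h3 := (hasDerivAt_iff_tendsto_slope.1 h2).eventually_const_lt hv
      have h4 : ∀ᶠ t in 𝓝 (0 : ℝ), t • v ∈ U :=
        hline.continuousAt.eventually (hU.mem_nhds (by simpa using h0U))
      rw [eventually_nhdsWithin_iff] at h3
      filter_upwards [h3.filter_mono nhdsWithin_le_nhds, h4.filter_mono nhdsWithin_le_nhds,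
        self_mem_nhdsWithin] with t ht1 ht2 ht3
      refine ⟨ht2, ?_⟩
      rcases eq_or_lt_of_le (show (0 : ℝ) ≤ t from ht3) with rfl | hpos
      · rw [zero_smul, hρ0]
      · have := ht1 (ne_of_gt hpos)
        rw [slope_def_field, zero_smul, hρ0, sub_zero, sub_zero] at this
        exact ((div_pos_iff_of_pos_right hpos).1 this).le
    have h5 : HasDerivWithinAt (fun t : ℝ => f (t • v)) 0 s 0 := by
      have := HasFDerivWithinAt.comp_hasDerivWithinAt (0 : ℝ) (l := f) (s := s)
        (f := fun t : ℝ => t • v) (by simpa using hf) hline.hasDerivWithinAt (fun t ht => ht)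
      simpa [Function.comp_def] using this
    exact (uniqueDiffWithinAt_Ici (0 : ℝ)).eq_deriv _ h1.hasDerivWithinAt
      (h5.mono_of_mem_nhdsWithin hs)
  obtain ⟨v₀, hv₀⟩ : ∃ v, 0 < ℓ v := by
    obtain ⟨v, hv⟩ : ∃ v, ℓ v ≠ 0 := by
      by_contra! h
      exact hρ.2 0 h0U hρ0 (ContinuousLinearMap.ext h)
    rcases lt_or_gt_of_ne hv with h | h
    · exact ⟨-v, by rw [map_neg]; linarith⟩
    · exact ⟨v, h⟩
  refine ContinuousLinearMap.ext fun v => ?_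
  have h1 := key (v + ((|ℓ v| + 1) / ℓ v₀) • v₀) (by
    rw [map_add, map_smul, smul_eq_mul, div_mul_cancel₀ _ hv₀.ne']
    linarith [neg_abs_le (ℓ v)])
  rw [map_add, map_smul, key v₀ hv₀, smul_zero, add_zero] at h1
  exact h1

variable [FiniteDimensional ℝ E]

/-- A frame which is smooth up to the hypersurface extends smoothly across it. -/
lemma exists_frame_extension (hU : IsOpen U) (h0U : 0 ∈ U) (hρ : IsDefiningFunction U ρ)
    (hρ0 : ρ 0 = 0) {W : Set E} (hW : IsOpen W) (h0W : 0 ∈ W) {X : Fin k → E → E}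
    (hX : IsSmoothFrameOn D ({p | p ∈ U ∧ 0 ≤ ρ p} ∩ W) X) :
    ∃ (X' : E → EuclideanSpace ℝ (Fin k) →L[ℝ] E) (U' : Set E), ContDiff ℝ ∞ X' ∧ IsOpen U' ∧
      0 ∈ U' ∧ U' ⊆ U ∩ W ∧ ∀ p ∈ U', 0 ≤ ρ p → X' p = frameMap X p ∧
        Function.Injective (X' p) ∧ LinearMap.range (X' p).toLinearMap = D p := by
  have hsub : {p | p ∈ U ∩ W ∧ 0 ≤ ρ p} ⊆ {p | p ∈ U ∧ 0 ≤ ρ p} ∩ W :=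
    fun p hp => ⟨⟨hp.1.1, hp.2⟩, hp.1.2⟩
  obtain ⟨X', hX', heq⟩ := exists_contDiff_extension_of_nonneg (hU.inter hW) ⟨h0U, h0W⟩
    (hρ.1.mono inter_subset_left) (hρ.2 0 h0U hρ0) ((contDiffOn_frameMap hX.1).mono hsub)
  obtain ⟨r, hr, hball⟩ := Metric.eventually_nhds_iff_ball.1
    (heq.and ((hU.inter hW).mem_nhds ⟨h0U, h0W⟩))
  refine ⟨X', Metric.ball 0 r, hX', Metric.isOpen_ball, Metric.mem_ball_self hr,
    fun p hp => (hball p hp).2, fun p hp hρp => ?_⟩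
  have hp' : p ∈ {p | p ∈ U ∧ 0 ≤ ρ p} ∩ W := hsub ⟨(hball p hp).2, hρp⟩
  rw [(hball p hp).1 hρp]
  exact ⟨rfl, hX.frameMap_injective hp', hX.range_frameMap hp'⟩

/-- If `T` is a left inverse of `Y 0`, then `C = (T ∘ Y)⁻¹` exists near the origin, and `Y ∘ C` is a
section of `T` with the same range as `Y`. -/
lemma exists_normalization {Y : E → EuclideanSpace ℝ (Fin k) →L[ℝ] E} (hY : ContDiff ℝ ∞ Y)
    (h0 : Function.Injective (Y 0)) :
    ∃ (T : E →L[ℝ] EuclideanSpace ℝ (Fin k))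
      (C : E → EuclideanSpace ℝ (Fin k) →L[ℝ] EuclideanSpace ℝ (Fin k)) (W : Set E),
      IsOpen W ∧ 0 ∈ W ∧ ContDiffOn ℝ ∞ C W ∧ ∀ p ∈ W, ∀ η,
        T (Y p (C p η)) = η ∧ C p (T (Y p η)) = η := by
  obtain ⟨T₀, hT₀⟩ := (Y 0).toLinearMap.exists_leftInverse_of_injective
    (LinearMap.ker_eq_bot.2 h0)
  set T : E →L[ℝ] EuclideanSpace ℝ (Fin k) := LinearMap.toContinuousLinearMap T₀
  have hTY : ContDiff ℝ ∞ fun p => T.comp (Y p) := contDiff_const.clm_comp hY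
  refine ⟨T, fun p => (T.comp (Y p)).inverse, (fun p => T.comp (Y p)) ⁻¹'
    range ((↑) : (EuclideanSpace ℝ (Fin k) ≃L[ℝ] EuclideanSpace ℝ (Fin k)) → _),
    ContinuousLinearEquiv.isOpen.preimage hTY.continuous, ?_, ?_, ?_⟩
  · refine ⟨ContinuousLinearEquiv.refl ℝ _, ?_⟩
    ext1 η
    exact (LinearMap.congr_fun hT₀ η).symm
  · rintro p ⟨L, hL⟩
    have := contDiffAt_map_inverse (𝕜 := ℝ) (n := ∞) L
    rw [hL] at this
    exact (this.comp p hTY.contDiffAt).contDiffWithinAt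
  · rintro p ⟨L, hL⟩ η
    have hL' : ∀ η, T (Y p η) = L η := fun η => (DFunLike.congr_fun hL η).symm
    simp only [← hL, ContinuousLinearMap.inverse_equiv]
    rw [hL', hL']
    simp

/-- The vanishing of the first derivatives of the normal components does not depend on the frame. -/
lemma hasFDerivAt_comp_frame_zero (hU : IsOpen U) (h0U : 0 ∈ U) (hρ : IsDefiningFunction U ρ)
    (hρ0 : ρ 0 = 0) {X Y : E → EuclideanSpace ℝ (Fin k) →L[ℝ] E} (hX : ContDiff ℝ ∞ X)
    (hY : ContDiff ℝ ∞ Y) (hY0 : Function.Injective (Y 0))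
    (hXY : ∀ᶠ p in 𝓝 0, 0 ≤ ρ p →
      LinearMap.range (X p).toLinearMap ≤ LinearMap.range (Y p).toLinearMap)
    {ℓ : E →L[ℝ] ℝ} (hℓ : ℓ.comp (Y 0) = 0)
    (hYd : HasFDerivAt (fun p => ℓ.comp (Y p)) (0 : E →L[ℝ] EuclideanSpace ℝ (Fin k) →L[ℝ] ℝ) 0) :
    HasFDerivAt (fun p => ℓ.comp (X p)) (0 : E →L[ℝ] EuclideanSpace ℝ (Fin k) →L[ℝ] ℝ) 0 := by
  obtain ⟨T, C, W, hW, h0W, hC, hTC⟩ := exists_normalization hY hY0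
  -- on the domain, `X = Y ∘ B` with `B` smooth
  set B : E → EuclideanSpace ℝ (Fin k) →L[ℝ] EuclideanSpace ℝ (Fin k) := fun p =>
    (C p).comp (T.comp (X p)) with hB
  have hXs : ContDiff ℝ ∞ fun p => ℓ.comp (X p) := contDiff_const.clm_comp hX
  have hBd : DifferentiableAt ℝ B 0 :=
    ((hC.contDiffAt (hW.mem_nhds h0W)).clm_comp
      (contDiffAt_const.clm_comp hX.contDiffAt)).differentiableAt (by simp)
  have h1 : HasFDerivAt (fun p => (ℓ.comp (Y p)).comp (B p))
      (0 : E →L[ℝ] EuclideanSpace ℝ (Fin k) →L[ℝ] ℝ) 0 := by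
    have := hYd.clm_comp hBd.hasFDerivAt
    simpa [hℓ] using this
  have h2 : HasFDerivAt (fun p => ℓ.comp (X p)) (fderiv ℝ (fun p => ℓ.comp (X p)) 0) 0 :=
    (hXs.differentiable (by simp) 0).hasFDerivAt
  have h3 := eq_zero_of_hasFDerivWithinAt_nonneg hU h0U hρ hρ0 (h2.sub h1) (by
    have hev : ∀ᶠ p in 𝓝 (0 : E), 0 ≤ ρ p → ℓ.comp (X p) - (ℓ.comp (Y p)).comp (B p) = 0 := by
      filter_upwards [hXY, hW.mem_nhds h0W] with p hp hpW hρp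
      rw [sub_eq_zero]
      ext1 η
      obtain ⟨ξ, hξ⟩ := hp hρp ⟨η, rfl⟩
      have hξ' : Y p ξ = X p η := hξ
      simp only [hB, ContinuousLinearMap.comp_apply]
      rw [← hξ', (hTC p hpW ξ).2]
    refine (hasFDerivWithinAt_const 0 (0 : E) _).congr_of_eventuallyEq ?_
      (hev.self_of_nhds hρ0.ge)
    filter_upwards [hev.filter_mono nhdsWithin_le_nhds, self_mem_nhdsWithin] with p hp hps
      using hp hps.2)
  rw [sub_zero] at h3
  rwa [h3] at h2

/-- The extension theorem for a commuting frame given near the origin. The frame `Y` is an auxiliary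
one, on which the condition on the linear parts of the normal components is imposed; the condition
passes to the commuting frame `X`. -/
theorem exists_extension_of_commuting_frame (hU : IsOpen U) (h0U : 0 ∈ U)
    (hρ : IsDefiningFunction U ρ) (hρ0 : ρ 0 = 0)
    (hcrit : ∀ v ∈ D 0, fderiv ℝ ρ 0 v = 0)
    (hneg : ∀ v ∈ D 0, v ≠ 0 → fderiv ℝ (fderiv ℝ ρ) 0 v v < 0)
    {Y : E → EuclideanSpace ℝ (Fin k) →L[ℝ] E} (hY : ContDiff ℝ ∞ Y)
    (hYD : ∀ᶠ p in 𝓝 0, 0 ≤ ρ p →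
      Function.Injective (Y p) ∧ LinearMap.range (Y p).toLinearMap = D p)
    (hYd : HasFDerivAt (fun p => (fderiv ℝ ρ 0).comp (Y p))
      (0 : E →L[ℝ] EuclideanSpace ℝ (Fin k) →L[ℝ] ℝ) 0)
    {W : Set E} (hW : IsOpen W) (h0W : 0 ∈ W) {X : Fin k → E → E}
    (hX : IsSmoothFrameOn D ({p | p ∈ U ∧ 0 ≤ ρ p} ∩ W) X)
    (hcomm : CommuteOn X (positiveSide U ρ ∩ W)) :
    ∃ (V : Set E) (D' : E → Submodule ℝ E) (X' : Fin k → E → E), IsOpen V ∧ 0 ∈ V ∧ V ⊆ U ∩ W ∧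
      IsIntegrableExtension k D (positiveSide U ρ) (hypersurface U ρ) D' V ∧
      IsSmoothFrameOn D' V X' ∧ CommuteOn X' V ∧
      ∀ i, ∀ p ∈ V ∩ (positiveSide U ρ ∪ hypersurface U ρ), X' i p = X i p := by
  obtain ⟨F, U', hF, hU', h0U', hU'sub, hFX⟩ :=
    exists_frame_extension hU h0U hρ hρ0 hW h0W hX
  set ℓ := fderiv ℝ ρ 0
  have hYD0 := hYD.self_of_nhds hρ0.ge
  have hFd : HasFDerivAt (fun p => ℓ.comp (F p))
      (0 : E →L[ℝ] EuclideanSpace ℝ (Fin k) →L[ℝ] ℝ) 0 := by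
    refine hasFDerivAt_comp_frame_zero hU h0U hρ hρ0 hF hY hYD0.1 ?_ ?_ hYd
    · filter_upwards [hYD, hU'.mem_nhds h0U'] with p hp1 hp2 hρp
      rw [(hFX p hp2 hρp).2.2, (hp1 hρp).2]
    · ext1 η
      exact hcrit _ (hYD0.2 ▸ ⟨η, rfl⟩)
  have hF0 := hFX 0 h0U' hρ0.ge
  have hFD0 : ∀ η, F 0 η ∈ D 0 := fun η => hF0.2.2 ▸ ⟨η, rfl⟩
  -- vanishing of the brackets, as symmetry of the bilinear map `(DF) F`
  have hFcomm : ∀ p ∈ U', 0 < ρ p → ∀ η ξ, fderiv ℝ F p (F p ξ) η = fderiv ℝ F p (F p η) ξ := by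
    intro p hp hρp
    have hFi : ∀ i, HasFDerivAt (X i)
        ((fderiv ℝ F p).flip (EuclideanSpace.single i 1)) p := by
      intro i
      have h1 : HasFDerivAt (fun q => F q (EuclideanSpace.single i 1))
          ((fderiv ℝ F p).flip (EuclideanSpace.single i 1)) p := by
        simpa using (hF.differentiable (by simp) p).hasFDerivAt.clm_apply
          (hasFDerivAt_const (EuclideanSpace.single i (1 : ℝ)) p)
      refine h1.congr_of_eventuallyEq ?_
      have hc : ContinuousAt ρ p :=
        (hρ.1.contDiffAt (hU.mem_nhds (hU'sub hp).1)).continuousAt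
      filter_upwards [hU'.mem_nhds hp, hc.eventually_const_lt hρp] with q hq hρq
      rw [(hFX q hq hρq.le).1, frameMap_single]
    have hFp : ∀ i, F p (EuclideanSpace.single i 1) = X i p := fun i => by
      rw [(hFX p hp hρp.le).1, frameMap_single]
    have hB : (fderiv ℝ F p).comp (F p) = ((fderiv ℝ F p).comp (F p)).flip := by
      refine ContinuousLinearMap.ext_single fun i => ContinuousLinearMap.ext_single fun j => ?_
      have h1 := hcomm i j p ⟨⟨(hU'sub hp).1, hρp⟩, (hU'sub hp).2⟩
      rw [VectorField.lieBracket, (hFi i).fderiv, (hFi j).fderiv, sub_eq_zero] at h1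
      simpa [hFp] using h1
    intro η ξ
    exact DFunLike.congr_fun (DFunLike.congr_fun hB ξ) η
  have hρ2 : HasFDerivAt (fderiv ℝ ρ) (fderiv ℝ (fderiv ℝ ρ) 0) 0 :=
    (((hρ.1.fderiv_of_isOpen hU (m := ∞) (by simp)).contDiffAt
      (hU.mem_nhds h0U)).differentiableAt (by simp)).hasFDerivAt
  -- only the Hessian of `ρ` contributes, as the derivative of `ℓ ∘ F` at the origin vanishes
  have hFneg : ∀ η ≠ 0, fderiv ℝ (fun p => (fderiv ℝ ρ p).comp (F p)) 0 (F 0 η) η < 0 := by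
    intro η hη
    have hFd' : HasFDerivAt F (fderiv ℝ F 0) 0 := (hF.differentiable (by simp) 0).hasFDerivAt
    have h1 := hρ2.clm_comp hFd'
    have h2 : ∀ v η, ℓ (fderiv ℝ F 0 v η) = 0 := by
      intro v η
      have h3 : HasFDerivAt (fun p => ℓ.comp (F p)) _ 0 := (hasFDerivAt_const ℓ 0).clm_comp hFd'
      have h4 := DFunLike.congr_fun (DFunLike.congr_fun (h3.unique hFd) v) η
      simpa using h4
    rw [h1.fderiv]
    have h5 := hneg _ (hFD0 η) (fun h => hη ((injective_iff_map_eq_zero _).1 hF0.2.1 η h))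
    have h6 := h2 (F 0 η) η
    simpa [ℓ, h6] using h5
  obtain ⟨e, he, hes, h0e, heU, heF, hc1, hc2⟩ := exists_straightening_chart
    (N := (D 0)ᗮ) (π := (D 0)ᗮ.orthogonalProjectionOnto) hF hU' h0U'
    (hρ.1.mono fun p hp => (hU'sub hp).1) hFcomm hF0.2.1
    (by ext1 η; exact hcrit _ (hFD0 η)) hFneg
    (fun v => ⟨v, by simp⟩) (fun v => by
      rw [Submodule.orthogonalProjectionOnto_eq_zero_iff, Submodule.orthogonal_orthogonal,
        ← hF0.2.2]
      rfl)
  -- the extension is tangent to the slices of the chart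
  have hside : ∀ p, p ∈ positiveSide U ρ ∪ hypersurface U ρ → 0 ≤ ρ p := by
    intro p hp
    rw [positiveSide_union_hypersurface] at hp
    exact hp.2
  have heX : ∀ p ∈ e.target, 0 ≤ ρ p → ∀ i, sliceFrame e i p = X i p := by
    intro p hp hρp i
    rw [sliceFrame, heF p hp hρp, (hFX p (heU hp) hρp).1, frameMap_single]
  have heD : ∀ p ∈ e.target, 0 ≤ ρ p → sliceDistribution e p = D p := by
    intro p hp hρp
    rw [← (hFX p (heU hp) hρp).2.2, sliceDistribution]
    congr 1
    ext1 η
    exact heF p hp hρp η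
  have hpos : e.target ∩ positiveSide U ρ = e.target ∩ {p | 0 < ρ p} := by
    ext p
    exact ⟨fun h => ⟨h.1, h.2.2⟩, fun h => ⟨h.1, (hU'sub (heU h.1)).1, h.2⟩⟩
  have hposo : IsOpen (e.target ∩ positiveSide U ρ) := by
    rw [hpos]
    exact (hρ.1.continuousOn.mono fun p hp => (hU'sub (heU hp)).1).isOpen_inter_preimage
      e.open_target isOpen_Ioi
  have hframe := isSmoothFrameOn_sliceFrame he hes
  refine ⟨e.target, sliceDistribution e, sliceFrame e, e.open_target, h0e,
    heU.trans hU'sub, ⟨?_, isIntegrableOn_sliceDistribution he hes,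
      fun p hp => heD p hp.1 (hside p hp.2), ?_⟩, hframe, commuteOn_sliceFrame he hes,
    fun i p hp => heX p hp.1 (hside p hp.2) i⟩
  · exact fun p _ => ⟨univ, sliceFrame e, isOpen_univ, mem_univ _, by rwa [inter_univ]⟩
  · refine foliationExtends_sliceDistribution he hes hposo
      (fun p hp => (heD p hp.1 hp.2.2.le).symm) hc1 fun c => ?_
    rw [hpos]
    exact hc2 c

/-- An integrable distribution has commuting frames near each point: a frame that a fixed linear
projection `T` maps to a constant frame commutes, as brackets are tangent to the distribution and
lie in the kernel of `T`. -/
lemma exists_commuting_frame (hU : IsOpen U) (hρ : IsDefiningFunction U ρ)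
    (hDint : IsIntegrableOn D (positiveSide U ρ))
    {Y : E → EuclideanSpace ℝ (Fin k) →L[ℝ] E} (hY : ContDiff ℝ ∞ Y) (hY0 : Function.Injective (Y 0))
    (hYD : ∀ᶠ p in 𝓝 0, 0 ≤ ρ p → LinearMap.range (Y p).toLinearMap = D p) :
    ∃ (W : Set E) (X : Fin k → E → E), IsOpen W ∧ 0 ∈ W ∧
      IsSmoothFrameOn D ({p | p ∈ U ∧ 0 ≤ ρ p} ∩ W) X ∧ CommuteOn X (positiveSide U ρ ∩ W) := by
  obtain ⟨T, C, W₁, hW₁, h0W₁, hC, hTC⟩ := exists_normalization hY hY0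
  obtain ⟨r, hr, hball⟩ := Metric.eventually_nhds_iff_ball.1 hYD
  set W := W₁ ∩ Metric.ball 0 r
  have hW : IsOpen W := hW₁.inter Metric.isOpen_ball
  set F : E → EuclideanSpace ℝ (Fin k) →L[ℝ] E := fun p => (Y p).comp (C p)
  have hF : ContDiffOn ℝ ∞ F W :=
    hY.contDiffOn.clm_comp (hC.mono inter_subset_left)
  have hTF : ∀ p ∈ W, ∀ η, T (F p η) = η := fun p hp η => (hTC p hp.1 η).1
  have hFD : ∀ p ∈ W, 0 ≤ ρ p → LinearMap.range (F p).toLinearMap = D p := by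
    intro p hp hρp
    rw [← hball p hp.2 hρp]
    apply le_antisymm
    · rintro _ ⟨η, rfl⟩
      exact ⟨C p η, rfl⟩
    · rintro _ ⟨η, rfl⟩
      refine ⟨T (Y p η), ?_⟩
      change Y p (C p (T (Y p η))) = Y p η
      rw [(hTC p hp.1 η).2]
  set X : Fin k → E → E := fun i p => F p (EuclideanSpace.single i 1)
  have hXs : ∀ i, ContDiffOn ℝ ∞ (X i) W := fun i => hF.clm_apply contDiffOn_const
  refine ⟨W, X, hW, ⟨h0W₁, Metric.mem_ball_self hr⟩, ⟨fun i => (hXs i).mono inter_subset_right,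
    fun p hp => ⟨?_, ?_⟩⟩, ?_⟩
  · rw [(F p).linearIndependent_single_iff]
    exact Function.LeftInverse.injective (g := T) (hTF p hp.2)
  · rw [(F p).span_range_single]
    exact hFD p hp.2 hp.1.2
  · intro i j p hp
    have hop : IsOpen (positiveSide U ρ ∩ W) :=
      (hρ.1.continuousOn.isOpen_inter_preimage hU isOpen_Ioi).inter hW
    have hmem : ∀ i, ∀ q ∈ positiveSide U ρ ∩ W, X i q ∈ D q := fun i q hq => by
      rw [← hFD q hq.2 hq.1.2.le]
      exact ⟨_, rfl⟩
    have hbr := hDint _ (X i) (X j) hop inter_subset_left ((hXs i).mono inter_subset_right)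
      ((hXs j).mono inter_subset_right) (hmem i) (hmem j) p hp
    rw [← hFD p hp.2 hp.1.2.le] at hbr
    obtain ⟨ξ, hξ⟩ := hbr
    have hξ' : F p ξ = VectorField.lieBracket ℝ (X i) (X j) p := hξ
    have hT : ∀ i v, T (fderiv ℝ (X i) p v) = 0 := by
      intro i v
      have h1 : HasFDerivAt (X i) (fderiv ℝ (X i) p) p :=
        (((hXs i).contDiffAt (hW.mem_nhds hp.2)).differentiableAt (by simp)).hasFDerivAt
      have h2 := T.hasFDerivAt.comp p h1
      have h3 : (T ∘ X i) =ᶠ[𝓝 p] fun _ => EuclideanSpace.single i 1 := by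
        filter_upwards [hW.mem_nhds hp.2] with q hq using hTF q hq _
      exact DFunLike.congr_fun (h2.unique ((hasFDerivAt_const _ p).congr_of_eventuallyEq h3)) v
    have h4 : T (VectorField.lieBracket ℝ (X i) (X j) p) = 0 := by
      rw [VectorField.lieBracket, map_sub, hT, hT, sub_zero]
    rw [← hξ', hTF p hp.2] at h4
    rw [← hξ', h4, map_zero]

end Core

/-! ### The extension theorem -/

theorem mainTheorem3 (m k : ℕ) (hk : 1 ≤ k) (hkm : k < m)
    (U : Set (EuclideanSpace ℝ (Fin m))) (hU : IsOpen U) (h0U : 0 ∈ U)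
    -- the hypersurface `M = {ρ = 0}`, its side `U⁺ = {ρ > 0}`
    (ρ : EuclideanSpace ℝ (Fin m) → ℝ) (hρ : IsDefiningFunction U ρ)
    (M Uplus : Set (EuclideanSpace ℝ (Fin m)))
    (hM : M = hypersurface U ρ) (hUplus : Uplus = positiveSide U ρ)
    (h0M : 0 ∈ M)
    -- the tangent space of `M` at the origin is `{x_m = 0}`
    (hT : ∀ v : EuclideanSpace ℝ (Fin m),
      fderiv ℝ ρ 0 v = 0 ↔ v ⟨m - 1, by omega⟩ = 0)
    -- the second fundamental form of `M` at the origin is `dx_1² + ⋯ + dx_k²`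
    (hII : ∀ v w : EuclideanSpace ℝ (Fin m), fderiv ℝ ρ 0 v = 0 → fderiv ℝ ρ 0 w = 0 →
      secondFundamentalForm ρ 0 v w =
        ∑ i : Fin k, v (Fin.castLE hkm.le i) * w (Fin.castLE hkm.le i))
    -- a smooth integrable distribution on `U⁺` that is smooth up to `M`
    (D : EuclideanSpace ℝ (Fin m) → Submodule ℝ (EuclideanSpace ℝ (Fin m)))
    (hD : IsSmoothDistributionOn k D (Uplus ∪ M)) (hDint : IsIntegrableOn D Uplus)
    -- the plane at the origin, and the linear parts of the normal components of some frame
    (hD0 : D 0 = Submodule.span ℝ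
      (range fun i : Fin k => EuclideanSpace.single (Fin.castLE hkm.le i) (1 : ℝ)))
    (hlin : ∃ (W : Set (EuclideanSpace ℝ (Fin m)))
      (Y : Fin k → EuclideanSpace ℝ (Fin m) → EuclideanSpace ℝ (Fin m)),
      IsOpen W ∧ 0 ∈ W ∧ IsSmoothFrameOn D ((Uplus ∪ M) ∩ W) Y ∧
      ∀ (i : Fin k) (j : Fin m), k ≤ (j : ℕ) →
        HasFDerivWithinAt (fun p => Y i p j)
          (0 : EuclideanSpace ℝ (Fin m) →L[ℝ] ℝ) (Uplus ∪ M) 0) :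
    (∃ (V : Set (EuclideanSpace ℝ (Fin m)))
      (D' : EuclideanSpace ℝ (Fin m) → Submodule ℝ (EuclideanSpace ℝ (Fin m))),
      IsOpen V ∧ 0 ∈ V ∧ V ⊆ U ∧ IsIntegrableExtension k D Uplus M D' V) ∧
    (∀ X : Fin k → EuclideanSpace ℝ (Fin m) → EuclideanSpace ℝ (Fin m),
      IsSmoothFrameOn D (Uplus ∪ M) X → CommuteOn X Uplus →
      ∃ (V : Set (EuclideanSpace ℝ (Fin m)))
        (D' : EuclideanSpace ℝ (Fin m) → Submodule ℝ (EuclideanSpace ℝ (Fin m)))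
        (X' : Fin k → EuclideanSpace ℝ (Fin m) → EuclideanSpace ℝ (Fin m)),
        IsOpen V ∧ 0 ∈ V ∧ V ⊆ U ∧ IsIntegrableExtension k D Uplus M D' V ∧
        IsSmoothFrameOn D' V X' ∧ CommuteOn X' V ∧
        ∀ i, ∀ p ∈ V ∩ (Uplus ∪ M), X' i p = X i p) := by
  subst hM hUplus
  have hρ0 : ρ 0 = 0 := h0M.2
  simp only [positiveSide_union_hypersurface] at hD hlin ⊢
  obtain ⟨W, Y₀, hW, h0W, hY₀, hY₀d⟩ := hlin
  obtain ⟨Y, U', hY, hU', h0U', hU'sub, hYX⟩ :=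
    exists_frame_extension hU h0U hρ hρ0 hW h0W hY₀
  set ℓ := fderiv ℝ ρ 0
  set n : Fin m := ⟨m - 1, by omega⟩
  have hℓ : ∀ v, ℓ v = ℓ (EuclideanSpace.single n 1) * v n := by
    intro v
    have h : ℓ (v - v n • EuclideanSpace.single n 1) = 0 := (hT _).2 (by simp)
    rw [map_sub, map_smul, sub_eq_zero, smul_eq_mul] at h
    rw [h, mul_comm]
  -- `D 0` is spanned by the first `k` basis vectors
  have hD0' : ∀ v ∈ D 0, ∀ j : Fin m, k ≤ (j : ℕ) → v j = 0 := by
    intro v hv j hj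
    rw [hD0] at hv
    induction hv using Submodule.span_induction with
    | mem x hx =>
      obtain ⟨i, rfl⟩ := hx
      have : j ≠ Fin.castLE hkm.le i := fun h => by
        have := congrArg Fin.val h
        simp at this
        omega
      simp [this]
    | zero => rfl
    | add x y _ _ hx hy => simp [hx, hy]
    | smul a x _ hx => simp [hx]
  have hcrit : ∀ v ∈ D 0, ℓ v = 0 := fun v hv =>
    (hT v).2 (hD0' v hv n (by simp only [n]; omega))
  have hneg : ∀ v ∈ D 0, v ≠ 0 → fderiv ℝ (fderiv ℝ ρ) 0 v v < 0 := by
    intro v hv hv0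
    have hpos : 0 < ∑ i : Fin k, v (Fin.castLE hkm.le i) * v (Fin.castLE hkm.le i) := by
      refine (Finset.sum_nonneg fun i _ => mul_self_nonneg _).lt_of_ne' fun h => hv0 ?_
      rw [Finset.sum_eq_zero_iff_of_nonneg fun i _ => mul_self_nonneg _] at h
      ext j
      by_cases hj : (j : ℕ) < k
      · exact mul_self_eq_zero.1 (h ⟨j, hj⟩ (Finset.mem_univ _))
      · exact hD0' v hv j (not_lt.1 hj)
    rw [← hII v v (hcrit v hv) (hcrit v hv), secondFundamentalForm,
      div_pos_iff_of_pos_right (norm_pos_iff.2 (hρ.2 0 h0U hρ0))] at hpos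
    exact neg_pos.1 hpos
  have hYD : ∀ᶠ p in 𝓝 0, 0 ≤ ρ p →
      Function.Injective (Y p) ∧ LinearMap.range (Y p).toLinearMap = D p := by
    filter_upwards [hU'.mem_nhds h0U'] with p hp hρp using (hYX p hp hρp).2
  -- `dρ` at the origin only sees the last component, whose derivative on one side is zero
  have hYd : HasFDerivAt (fun p => ℓ.comp (Y p))
      (0 : EuclideanSpace ℝ (Fin m) →L[ℝ] EuclideanSpace ℝ (Fin k) →L[ℝ] ℝ) 0 := by
    have h1 : HasFDerivAt (fun p => ℓ.comp (Y p)) (fderiv ℝ (fun p => ℓ.comp (Y p)) 0) 0 :=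
      ((contDiff_const.clm_comp hY).differentiable (by simp) 0).hasFDerivAt
    suffices h : fderiv ℝ (fun p => ℓ.comp (Y p)) 0 = 0 by rwa [h] at h1
    ext1 v
    refine ContinuousLinearMap.ext_single fun i => ?_
    have h2 : HasFDerivAt (fun p => ℓ (Y p (EuclideanSpace.single i 1)))
        ((fderiv ℝ (fun p => ℓ.comp (Y p)) 0).flip (EuclideanSpace.single i 1)) 0 := by
      simpa using h1.clm_apply (hasFDerivAt_const (EuclideanSpace.single i (1 : ℝ)) 0)
    refine DFunLike.congr_fun (eq_zero_of_hasFDerivWithinAt_nonneg hU h0U hρ hρ0 h2 ?_) v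
    have h3 := (hY₀d i n (by simp only [n]; omega)).const_mul (ℓ (EuclideanSpace.single n 1))
    rw [smul_zero] at h3
    have hev : ∀ᶠ p in 𝓝 0, 0 ≤ ρ p → ℓ (Y p (EuclideanSpace.single i 1)) =
        ℓ (EuclideanSpace.single n 1) * Y₀ i p n := by
      filter_upwards [hU'.mem_nhds h0U'] with p hp hρp
      rw [(hYX p hp hρp).1, frameMap_single, hℓ]
    refine h3.congr_of_eventuallyEq ?_ (hev.self_of_nhds hρ0.ge)
    filter_upwards [hev.filter_mono nhdsWithin_le_nhds, self_mem_nhdsWithin] with p hp hps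
      using hp hps.2
  constructor
  · obtain ⟨W', X, hW', h0W', hX, hcomm⟩ := exists_commuting_frame hU hρ hDint hY
      (hYD.self_of_nhds hρ0.ge).1 (hYD.mono fun p hp hρp => (hp hρp).2)
    obtain ⟨V, D', -, hV, h0V, hVU, hext, -⟩ := exists_extension_of_commuting_frame hU h0U hρ hρ0
      hcrit hneg hY hYD hYd hW' h0W' hX hcomm
    exact ⟨V, D', hV, h0V, hVU.trans inter_subset_left, hext⟩
  · intro X hX hcomm
    obtain ⟨V, D', X', hV, h0V, hVU, hext, hX', hcomm', heq⟩ :=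
      exists_extension_of_commuting_frame hU h0U hρ hρ0 hcrit hneg hY hYD hYd isOpen_univ
        (mem_univ 0) (by rwa [inter_univ]) (by rwa [inter_univ])
    exact ⟨V, D', X', hV, h0V, hVU.trans inter_subset_left, hext, hX', hcomm',
      by rwa [positiveSide_union_hypersurface] at heq⟩
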